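/- Let $\mathbb{T}=\mathbb{R}/2\pi\mathbb{Z}$. For $a,b>0$ let $$\Delta(a,b)=\{(x,y)\in\mathbb{R}^2:\ a|x|+b|y|\le 1\},\qquad \rho(\Delta(a,b))=\frac{\max\{a,b\}}{\min\{a,b\}}.$$ For $f\in L^1(\mathbb{T}^2)$ and a bounded region $G\subset\mathbb{R}^2$ let $$S_G(x,y,f)=\sum_{(n,m)\in G\cap\mathbb{Z}^2}c_{nm}e^{i(nx+my)},\qquad c_{nm}=\frac{1}{4\pi^2}\int_{\mathbb{T}^2}f(x,y)e^{-i(nx+my)}\,dx\,dy,$$ be the partial sum over $G$ of the double Fourier series of $f$. Theorem. There exist a real continuous function $f\in C(\mathbb{T}^2)$ and a sequence of rhombi $\Delta_k=\Delta(a_k,b_k)$, $a_k,b_k>0$, $k=1,2,\dots$, such that $\bigcup_{k}\Delta_k=\mathbb{R}^2$, $\Delta_k\subset\Delta_{k+1}$ for all $k$, $\rho(\Delta_k)\to1$ as $k\to\infty$, and $$\limsup_{k\to\infty}|S_{\Delta_k}(x,y,f)|=\infty$$ for almost every $(x,y)\in\mathbb{T}^2$. -/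

import Mathlib

open MeasureTheory Filter Topology

/-- The positivity of the period `2π`, needed for the measure on the circle `ℝ / 2πℤ`. -/
instance fact_two_pi_pos : Fact (0 < 2 * Real.pi) := ⟨Real.two_pi_pos⟩

/-- The torus `𝕋² = 𝕋 × 𝕋`, where `𝕋 = ℝ / 2πℤ`. Its `volume` is Lebesgue measure, of total
mass `4π²`. -/
abbrev Torus2 : Type := AddCircle (2 * Real.pi) × AddCircle (2 * Real.pi)

/-- The exponential `(x, y) ↦ e^{i(nx + my)}` on the torus
(on `ℝ / 2πℤ`, Mathlib's `fourier n` is `x ↦ e^{inx}`). -/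
noncomputable def expo (n m : ℤ) (p : Torus2) : ℂ := fourier n p.1 * fourier m p.2

/-- The Fourier coefficient `c_{nm} = (1 / 4π²) ∫ f(x, y) e^{-i(nx + my)} dx dy`. -/
noncomputable def doubleFourierCoeff (f : Torus2 → ℂ) (n m : ℤ) : ℂ :=
  (1 / (4 * (Real.pi : ℂ) ^ 2)) * ∫ p : Torus2, f p * expo (-n) (-m) p

/-- The partial sum `S_G(x, y, f) = ∑_{(n, m) ∈ G} c_{nm} e^{i(nx + my)}` of the double Fourier
series of `f` over a bounded region `G` of the plane (a finite sum, by `finite_lattice_points`). -/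
noncomputable def partialSum (G : Set (ℝ × ℝ)) (f : Torus2 → ℂ) (p : Torus2) : ℂ :=
  ∑ᶠ (k : ℤ × ℤ) (_ : ((k.1 : ℝ), (k.2 : ℝ)) ∈ G), doubleFourierCoeff f k.1 k.2 * expo k.1 k.2 p

/-- The rhombus `Δ(a, b) = {(x, y) ∈ ℝ² : a|x| + b|y| ≤ 1}`. -/
def rhombus (a b : ℝ) : Set (ℝ × ℝ) := {z | a * |z.1| + b * |z.2| ≤ 1}

/-- The ratio `ρ(Δ(a, b)) = max{a, b} / min{a, b}`. -/
noncomputable def rho (a b : ℝ) : ℝ := max a b / min a b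

/-- A bounded region of the plane contains only finitely many integer points. -/
theorem finite_lattice_points {G : Set (ℝ × ℝ)} (hG : Bornology.IsBounded G) :
    {k : ℤ × ℤ | ((k.1 : ℝ), (k.2 : ℝ)) ∈ G}.Finite := by
  obtain ⟨R, hR⟩ := hG.exists_norm_le
  refine ((Set.finite_Icc (-⌈R⌉) ⌈R⌉).prod (Set.finite_Icc (-⌈R⌉) ⌈R⌉)).subset ?_
  rintro ⟨n, m⟩ hk
  have h := hR _ hk
  rw [Prod.norm_def, max_le_iff, Real.norm_eq_abs, Real.norm_eq_abs, abs_le, abs_le] at h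
  obtain ⟨⟨h1, h2⟩, h3, h4⟩ := h
  have hc := Int.le_ceil R
  simp only [Set.mem_prod, Set.mem_Icc]
  refine ⟨⟨?_, ?_⟩, ?_, ?_⟩ <;>
    · rify
      dsimp only at h1 h2 h3 h4
      linarith

/-- The rhombi with positive parameters are bounded. -/
theorem isBounded_rhombus {a b : ℝ} (ha : 0 < a) (hb : 0 < b) :
    Bornology.IsBounded (rhombus a b) := by
  refine isBounded_iff_forall_norm_le.2 ⟨max (1 / a) (1 / b), fun z hz => ?_⟩
  have hz' : a * |z.1| + b * |z.2| ≤ 1 := hz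
  have h1 : 0 ≤ a * |z.1| := by positivity
  have h2 : 0 ≤ b * |z.2| := by positivity
  rw [Prod.norm_def, Real.norm_eq_abs, Real.norm_eq_abs]
  refine max_le_max ?_ ?_
  · rw [le_div_iff₀ ha]; linarith
  · rw [le_div_iff₀ hb]; linarith

/-- The normalised Haar measure on the torus. -/
noncomputable def torusHaar : Measure Torus2 :=
  (AddCircle.haarAddCircle (T := 2 * Real.pi)).prod (AddCircle.haarAddCircle (T := 2 * Real.pi))

instance isProbabilityMeasure_torusHaar : IsProbabilityMeasure torusHaar := by
  unfold torusHaar; infer_instance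

instance isAddHaarMeasure_torusHaar : torusHaar.IsAddHaarMeasure := by
  unfold torusHaar; infer_instance

theorem volume_torus_eq :
    (volume : Measure Torus2) = ENNReal.ofReal (4 * Real.pi ^ 2) • torusHaar := by
  have h : (4 * Real.pi ^ 2 : ℝ) = (2 * Real.pi) * (2 * Real.pi) := by ring
  rw [Measure.volume_eq_prod, AddCircle.volume_eq_smul_haarAddCircle, Measure.prod_smul_left,
    Measure.prod_smul_right, smul_smul, torusHaar, h,
    ENNReal.ofReal_mul (p := 2 * Real.pi) (by positivity)]

theorem integrable_torusHaar {E : Type*} [NormedAddCommGroup E] [SecondCountableTopology E]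
    [MeasurableSpace E] [BorelSpace E] {f : Torus2 → E}
    (hf : Continuous f) : Integrable f torusHaar :=
  hf.integrable_of_hasCompactSupport (HasCompactSupport.of_compactSpace _)

/-- The exponentials as bundled continuous maps. -/
noncomputable def expoC (k : ℤ × ℤ) : C(Torus2, ℂ) :=
  (fourier k.1).comp ContinuousMap.fst * (fourier k.2).comp ContinuousMap.snd

theorem expoC_zero : expoC 0 = 1 := by
  ext p; simp [expoC]

theorem expoC_add (k l : ℤ × ℤ) : expoC (k + l) = expoC k * expoC l := by
  ext p
  simp only [expoC, ContinuousMap.mul_apply, ContinuousMap.comp_apply, Prod.fst_add, Prod.snd_add,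
    fourier_add]
  ring

theorem star_expoC (k : ℤ × ℤ) : star (expoC k) = expoC (-k) := by
  ext p
  simp [expoC]

theorem norm_expoC_apply (k : ℤ × ℤ) (p : Torus2) : ‖expoC k p‖ = 1 := by
  rw [expoC, ContinuousMap.mul_apply, norm_mul]
  simp only [ContinuousMap.comp_apply, fourier_apply]
  rw [Circle.norm_coe, Circle.norm_coe, one_mul]

/-- Precomposition with multiplication by `Q` on the torus. -/
noncomputable def dil (Q : ℕ) : C(Torus2, ℂ) →ₐ[ℂ] C(Torus2, ℂ) :=
  ContinuousMap.compRightAlgHom ℂ ℂ ⟨fun p => Q • p, continuous_nsmul Q⟩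

theorem dil_apply (Q : ℕ) (f : C(Torus2, ℂ)) (p : Torus2) : dil Q f p = f (Q • p) := rfl

theorem dil_expoC (Q : ℕ) (k : ℤ × ℤ) : dil Q (expoC k) = expoC (Q • k) := by
  ext p
  have h : ∀ (n : ℤ) (x : AddCircle (2 * Real.pi)), fourier n (Q • x) = fourier ((Q : ℤ) * n) x := by
    intro n x
    rw [fourier_apply, fourier_apply, ← natCast_zsmul, smul_smul, Int.mul_comm n]
  simp [dil_apply, expoC, h]

theorem dil_star (Q : ℕ) (f : C(Torus2, ℂ)) : dil Q (star f) = star (dil Q f) := rfl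

/-- Trigonometric polynomials with frequencies in `S`. -/
noncomputable def trigPoly (S : Set (ℤ × ℤ)) : Submodule ℂ C(Torus2, ℂ) :=
  Submodule.span ℂ (expoC '' S)

theorem trigPoly_mono {S S' : Set (ℤ × ℤ)} (h : S ⊆ S') : trigPoly S ≤ trigPoly S' :=
  Submodule.span_mono (Set.image_mono h)

theorem expoC_mem {S : Set (ℤ × ℤ)} {k : ℤ × ℤ} (h : k ∈ S) : expoC k ∈ trigPoly S :=
  Submodule.subset_span ⟨k, h, rfl⟩

theorem trigPoly_induction {S : Set (ℤ × ℤ)} {P : C(Torus2, ℂ) → Prop} {u : C(Torus2, ℂ)}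
    (hu : u ∈ trigPoly S) (he : ∀ k ∈ S, P (expoC k)) (h0 : P 0)
    (hadd : ∀ u v, P u → P v → P (u + v)) (hsmul : ∀ (c : ℂ) u, P u → P (c • u)) : P u := by
  refine Submodule.span_induction (p := fun x _ => P x) ?_ h0 (fun x y _ _ => hadd x y)
    (fun a x _ => hsmul a x) hu
  rintro _ ⟨k, hk, rfl⟩
  exact he k hk

theorem trigPoly_mul {S : Set (ℤ × ℤ)} (hS : ∀ k ∈ S, ∀ l ∈ S, k + l ∈ S) {u v : C(Torus2, ℂ)}
    (hu : u ∈ trigPoly S) (hv : v ∈ trigPoly S) : u * v ∈ trigPoly S := by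
  refine trigPoly_induction (P := fun w => w * v ∈ trigPoly S) hu (fun k hk => ?_) (by simp)
    (fun a b ha hb => ?_) (fun c a ha => ?_)
  · refine trigPoly_induction (P := fun w => expoC k * w ∈ trigPoly S) hv (fun l hl => ?_)
      (by simp) (fun a b ha hb => ?_) (fun c a ha => ?_)
    · rw [← expoC_add]; exact expoC_mem (hS k hk l hl)
    · rw [mul_add]; exact add_mem ha hb
    · rw [mul_smul_comm]; exact Submodule.smul_mem _ _ ha
  · rw [add_mul]; exact add_mem ha hb
  · rw [smul_mul_assoc]; exact Submodule.smul_mem _ _ ha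

/-- The algebra of all trigonometric polynomials. -/
noncomputable def trigAlg : Subalgebra ℂ C(Torus2, ℂ) :=
  (trigPoly Set.univ).toSubalgebra (by rw [← expoC_zero]; exact expoC_mem trivial)
    (fun _ _ hu hv => trigPoly_mul (fun _ _ _ _ => Set.mem_univ _) hu hv)

theorem mem_trigAlg {u : C(Torus2, ℂ)} : u ∈ trigAlg ↔ u ∈ trigPoly Set.univ := Iff.rfl

theorem trigPoly_le {S : Set (ℤ × ℤ)} {u : C(Torus2, ℂ)} (hu : u ∈ trigPoly S) : u ∈ trigAlg :=
  trigPoly_mono (Set.subset_univ S) hu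

theorem expoC_mem_trigAlg (k : ℤ × ℤ) : expoC k ∈ trigAlg := trigPoly_le (expoC_mem (Set.mem_univ k))

theorem star_mem_trigAlg {u : C(Torus2, ℂ)} (hu : u ∈ trigAlg) : star u ∈ trigAlg := by
  refine trigPoly_induction (P := fun w => star w ∈ trigAlg)
    (mem_trigAlg.1 hu) (fun k _ => ?_) (by simp) (fun a b ha hb => ?_)
    (fun c a ha => ?_)
  · rw [star_expoC]; exact expoC_mem_trigAlg _
  · rw [star_add]; exact add_mem ha hb
  · rw [star_smul]; exact Subalgebra.smul_mem _ ha _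

theorem dil_mem_trigAlg (Q : ℕ) {u : C(Torus2, ℂ)} (hu : u ∈ trigAlg) : dil Q u ∈ trigAlg := by
  refine trigPoly_induction (P := fun w => dil Q w ∈ trigAlg)
    (mem_trigAlg.1 hu) (fun k _ => ?_) (by simp) (fun a b ha hb => ?_)
    (fun c a ha => ?_)
  · rw [dil_expoC]; exact expoC_mem_trigAlg _
  · rw [map_add]; exact add_mem ha hb
  · rw [map_smul]; exact Subalgebra.smul_mem _ ha _

/-- The mean value of a continuous function on the torus. -/
noncomputable def mean : C(Torus2, ℂ) →ₗ[ℂ] ℂ where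
  toFun f := ∫ p, f p ∂torusHaar
  map_add' f g := integral_add (integrable_torusHaar f.continuous) (integrable_torusHaar g.continuous)
  map_smul' c _ := integral_const_mul c _

theorem mean_def (f : C(Torus2, ℂ)) : mean f = ∫ p, f p ∂torusHaar := rfl

theorem integral_fourier_haar (n : ℤ) :
    ∫ x, fourier n x ∂(AddCircle.haarAddCircle (T := 2 * Real.pi)) = if n = 0 then 1 else 0 := by
  split_ifs with h
  · subst h; simp
  · exact integral_eq_zero_of_add_right_eq_neg (fourier_add_half_inv_index h Real.two_pi_pos)

theorem mean_expoC (k : ℤ × ℤ) : mean (expoC k) = if k = 0 then 1 else 0 := by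
  have h : mean (expoC k) = (∫ x, fourier k.1 x ∂(AddCircle.haarAddCircle (T := 2 * Real.pi))) *
      ∫ y, fourier k.2 y ∂(AddCircle.haarAddCircle (T := 2 * Real.pi)) := by
    rw [mean_def, torusHaar, ← integral_prod_mul]; rfl
  rw [h, integral_fourier_haar, integral_fourier_haar]
  by_cases h1 : k.1 = 0 <;> by_cases h2 : k.2 = 0 <;> simp [h1, h2, Prod.ext_iff]

theorem mean_one : mean 1 = 1 := by
  rw [← expoC_zero, mean_expoC, if_pos rfl]

theorem eventually_add_nsmul_ne_zero (b k : ℤ × ℤ) (hk : k ≠ 0) :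
    ∀ᶠ Q : ℕ in atTop, b + Q • k ≠ 0 := by
  filter_upwards [eventually_gt_atTop (b.1.natAbs + b.2.natAbs)] with Q hQ h
  apply hk
  have h1 : b.1 + Q * k.1 = 0 := by simpa using congrArg Prod.fst h
  have h2 : b.2 + Q * k.2 = 0 := by simpa using congrArg Prod.snd h
  have key : ∀ c l : ℤ, c + Q * l = 0 → c.natAbs < Q → l = 0 := by
    intro c l hc hlt
    have hd : (Q : ℤ) ∣ c := ⟨-l, by linarith⟩
    have hz : c = 0 := Int.eq_zero_of_abs_lt_dvd hd (by rw [Int.abs_eq_natAbs]; exact_mod_cast hlt)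
    rcases mul_eq_zero.1 (show (Q : ℤ) * l = 0 by linarith) with h | h
    · omega
    · exact h
  exact Prod.ext (key _ _ h1 (by omega)) (key _ _ h2 (by omega))

/-- Asymptotic independence under dilation, which is exact for trigonometric polynomials. -/
theorem eventually_mean_mul_dil {u v : C(Torus2, ℂ)} (hu : u ∈ trigAlg) (hv : v ∈ trigAlg) :
    ∀ᶠ Q : ℕ in atTop, mean (u * dil Q v) = mean u * mean v := by
  refine trigPoly_induction (P := fun w => ∀ᶠ Q : ℕ in atTop, mean (w * dil Q v) = mean w * mean v)
    (mem_trigAlg.1 hu) (fun k _ => ?_) (by simp) (fun a b ha hb => ?_)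
    (fun c a ha => ?_)
  · refine trigPoly_induction
      (P := fun w => ∀ᶠ Q : ℕ in atTop, mean (expoC k * dil Q w) = mean (expoC k) * mean w)
      (mem_trigAlg.1 hv) (fun l _ => ?_) (by simp) (fun a b ha hb => ?_)
      (fun c a ha => ?_)
    · by_cases hl : l = 0
      · subst hl
        simp [expoC_zero, mean_one]
      · filter_upwards [eventually_add_nsmul_ne_zero k l hl] with Q hQ
        rw [dil_expoC, ← expoC_add, mean_expoC, mean_expoC l, if_neg hQ, if_neg hl, mul_zero]
    · filter_upwards [ha, hb] with Q h1 h2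
      rw [map_add, mul_add, map_add, h1, h2, map_add, mul_add]
    · filter_upwards [ha] with Q h1
      rw [map_smul, mul_smul_comm, map_smul, h1, map_smul, smul_eq_mul, smul_eq_mul]; ring
  · filter_upwards [ha, hb] with Q h1 h2
    rw [add_mul, map_add, h1, h2, map_add, add_mul]
  · filter_upwards [ha] with Q h1
    rw [smul_mul_assoc, map_smul, h1, map_smul, smul_eq_mul, smul_eq_mul]; ring

/-- A set of frequencies that swallows all translates of large multiples of its elements. -/
def Absorbing (K : Set (ℤ × ℤ)) : Prop :=
  ∀ b, ∀ k ∈ K, ∀ᶠ Q : ℕ in atTop, b + Q • k ∈ K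

theorem Absorbing.union {K K' : Set (ℤ × ℤ)} (h : Absorbing K) (h' : Absorbing K') :
    Absorbing (K ∪ K') := by
  rintro b k (hk | hk)
  · exact (h b k hk).mono fun _ => Or.inl
  · exact (h' b k hk).mono fun _ => Or.inr

theorem Absorbing.eventually_mul_dil_mem {K : Set (ℤ × ℤ)} (hK : Absorbing K) {u v : C(Torus2, ℂ)}
    (hu : u ∈ trigAlg) (hv : v ∈ trigPoly K) : ∀ᶠ Q : ℕ in atTop, u * dil Q v ∈ trigPoly K := by
  refine trigPoly_induction (P := fun w => ∀ᶠ Q : ℕ in atTop, w * dil Q v ∈ trigPoly K)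
    (mem_trigAlg.1 hu) (fun k _ => ?_) (by simp) (fun a b ha hb => ?_)
    (fun c a ha => ?_)
  · refine trigPoly_induction (P := fun w => ∀ᶠ Q : ℕ in atTop, expoC k * dil Q w ∈ trigPoly K)
      hv (fun l hl => ?_) (by simp) (fun a b ha hb => ?_) (fun c a ha => ?_)
    · filter_upwards [hK k l hl] with Q hQ
      rw [dil_expoC, ← expoC_add]; exact expoC_mem hQ
    · filter_upwards [ha, hb] with Q h1 h2
      rw [map_add, mul_add]; exact add_mem h1 h2
    · filter_upwards [ha] with Q h1
      rw [map_smul, mul_smul_comm]; exact Submodule.smul_mem _ _ h1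
  · filter_upwards [ha, hb] with Q h1 h2
    rw [add_mul]; exact add_mem h1 h2
  · filter_upwards [ha] with Q h1
    rw [smul_mul_assoc]; exact Submodule.smul_mem _ _ h1

/-- The frequencies `(n, m)` with `n > 0` for which `-m / n` lies strictly between `s` and `t`. -/
def slopeCone (s t : ℝ) : Set (ℤ × ℤ) :=
  {k | 0 < k.1 ∧ s * k.1 < -k.2 ∧ -(k.2 : ℝ) < t * k.1}

theorem slopeCone_mono {s s' t t' : ℝ} (hs : s' ≤ s) (ht : t ≤ t') :
    slopeCone s t ⊆ slopeCone s' t' := by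
  rintro k ⟨h1, h2, h3⟩
  have : (0 : ℝ) < k.1 := by exact_mod_cast h1
  exact ⟨h1, by nlinarith, by nlinarith⟩

theorem eventually_add_nat_mul_pos (b k : ℝ) (hk : 0 < k) : ∀ᶠ Q : ℕ in atTop, 0 < b + Q * k :=
  (tendsto_atTop_add_const_left _ _
    (tendsto_natCast_atTop_atTop.atTop_mul_const hk)).eventually_gt_atTop 0

theorem absorbing_slopeCone (s t : ℝ) : Absorbing (slopeCone s t) := by
  rintro b k ⟨h1, h2, h3⟩
  have h1' : (0 : ℝ) < k.1 := by exact_mod_cast h1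
  filter_upwards [eventually_add_nat_mul_pos b.1 k.1 h1',
    eventually_add_nat_mul_pos (-b.2 - s * b.1) (-k.2 - s * k.1) (by linarith),
    eventually_add_nat_mul_pos (t * b.1 + b.2) (t * k.1 + k.2) (by linarith)] with Q q1 q2 q3
  have e1 : (b + Q • k).1 = b.1 + Q * k.1 := by simp
  have e2 : (b + Q • k).2 = b.2 + Q * k.2 := by simp
  refine ⟨by rw [e1]; exact_mod_cast q1, ?_, ?_⟩ <;>
  · rw [e1, e2]
    push_cast
    linarith

theorem Absorbing.neg {K : Set (ℤ × ℤ)} (hK : Absorbing K) : Absorbing {k | -k ∈ K} := by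
  intro b k hk
  filter_upwards [hK (-b) (-k) hk] with Q hQ
  simpa [add_comm] using hQ

theorem measurePreserving_nsmul_torus {Q : ℕ} (hQ : Q ≠ 0) :
    MeasurePreserving (fun p : Torus2 => Q • p) torusHaar torusHaar := by
  have hs : Function.Surjective (nsmulAddMonoidHom (α := Torus2) Q) := by
    rintro ⟨x, y⟩
    have hQ' : (Q : ℤ) ≠ 0 := by exact_mod_cast hQ
    refine ⟨(DivisibleBy.div x (Q : ℤ), DivisibleBy.div y (Q : ℤ)), Prod.ext ?_ ?_⟩
    · simpa using DivisibleBy.div_cancel x hQ'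
    · simpa using DivisibleBy.div_cancel y hQ'
  exact (nsmulAddMonoidHom (α := Torus2) Q).measurePreserving (continuous_nsmul Q) hs (by simp)

/-- The homomorphism of the torus onto the circle with frequency `k`. -/
noncomputable def freqHom (k : ℤ × ℤ) : Torus2 →+ AddCircle (2 * Real.pi) where
  toFun p := k.1 • p.1 + k.2 • p.2
  map_zero' := by simp
  map_add' p q := by simp only [Prod.fst_add, Prod.snd_add, smul_add]; abel

theorem expoC_eq_fourier_freqHom (k : ℤ × ℤ) (p : Torus2) :
    expoC k p = fourier 1 (freqHom k p) := by
  simp [expoC, freqHom, fourier_apply, AddCircle.toCircle_add]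

theorem measurePreserving_freqHom {k : ℤ × ℤ} (hk : k.1 ≠ 0) :
    MeasurePreserving (freqHom k) torusHaar (AddCircle.haarAddCircle (T := 2 * Real.pi)) := by
  have hs : Function.Surjective (freqHom k) := fun x =>
    ⟨(DivisibleBy.div x k.1, 0), by
      simpa [freqHom] using DivisibleBy.div_cancel (α := ℤ) x hk⟩
  have hc : Continuous (freqHom k) := by
    change Continuous fun p : Torus2 => k.1 • p.1 + k.2 • p.2
    fun_prop
  exact (freqHom k).measurePreserving hc hs (by simp)

/-- The normalised Haar measure on the circle `ℝ / 2πℤ`. -/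
noncomputable abbrev circleHaar : Measure (AddCircle (2 * Real.pi)) := AddCircle.haarAddCircle

/-- The cosine on the circle `ℝ / 2πℤ`. -/
noncomputable def circleCos (x : AddCircle (2 * Real.pi)) : ℝ := (fourier 1 x : ℂ).re

theorem continuous_circleCos : Continuous circleCos :=
  Complex.continuous_re.comp (fourier 1).continuous

theorem norm_fourier_one (x : AddCircle (2 * Real.pi)) : ‖(fourier 1 x : ℂ)‖ = 1 := by
  simp only [fourier_apply]; exact Circle.norm_coe _

theorem circleCos_mem (x : AddCircle (2 * Real.pi)) : circleCos x ∈ Set.Icc (-1 : ℝ) 1 := by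
  have h := Complex.abs_re_le_norm (fourier 1 x : ℂ)
  rw [norm_fourier_one] at h
  exact abs_le.1 h

theorem integrable_circleHaar {f : AddCircle (2 * Real.pi) → ℝ} (hf : Continuous f) :
    Integrable f circleHaar :=
  hf.integrable_of_hasCompactSupport (HasCompactSupport.of_compactSpace _)

theorem integral_re_fourier (n : ℤ) (hn : n ≠ 0) :
    ∫ x, (fourier n x : ℂ).re ∂circleHaar = 0 := by
  have h := integral_fourier_haar n
  rw [if_neg hn] at h
  have hi : Integrable (fun x => (fourier n x : ℂ)) circleHaar :=
    (fourier n).continuous.integrable_of_hasCompactSupport (HasCompactSupport.of_compactSpace _)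
  have h2 := integral_re hi
  rw [h] at h2
  simpa using h2

theorem integral_circleCos : ∫ x, circleCos x ∂circleHaar = 0 := integral_re_fourier 1 one_ne_zero

theorem integral_circleCos_sq : ∫ x, circleCos x ^ 2 ∂circleHaar = 1 / 2 := by
  have h : ∀ x, circleCos x ^ 2 = (1 + (fourier 2 x : ℂ).re) / 2 := by
    intro x
    have h1 : (fourier 2 x : ℂ) = fourier 1 x * fourier 1 x := by
      rw [← fourier_add]; norm_num
    have h2 := Complex.sq_norm (fourier 1 x : ℂ)
    rw [norm_fourier_one, Complex.normSq_apply] at h2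
    rw [h1, Complex.mul_re, circleCos]
    nlinarith
  simp_rw [h]
  rw [integral_div, integral_add (integrable_const _), integral_re_fourier 2 two_ne_zero]
  · simp
  · exact integrable_circleHaar (Complex.continuous_re.comp (fourier 2).continuous)

theorem measure_circleCos_eq_zero : circleHaar {x | circleCos x = 0} = 0 := by
  have hsub : {x | circleCos x = 0} ⊆ (fun x => (fourier 1 x : ℂ)) ⁻¹' {Complex.I, -Complex.I} := by
    intro x hx
    have h2 := Complex.sq_norm (fourier 1 x : ℂ)
    have hx' : (fourier 1 x : ℂ).re = 0 := hx
    rw [norm_fourier_one, Complex.normSq_apply, hx'] at h2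
    have h3 : ((fourier 1 x : ℂ).im - 1) * ((fourier 1 x : ℂ).im + 1) = 0 := by nlinarith
    rcases mul_eq_zero.1 h3 with h | h
    · exact Or.inl (Complex.ext (by rw [hx', Complex.I_re]) (by rw [Complex.I_im]; linarith))
    · refine Or.inr (Complex.ext ?_ ?_)
      · rw [hx', Complex.neg_re, Complex.I_re, neg_zero]
      · rw [Complex.neg_im, Complex.I_im]; linarith
  have hinj : Function.Injective (fun x : AddCircle (2 * Real.pi) => (fourier 1 x : ℂ)) := by
    intro x y hxy
    simp only [fourier_apply, one_zsmul] at hxy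
    exact AddCircle.injective_toCircle Real.two_pi_pos.ne' (Subtype.ext hxy)
  have hfin : ((fun x : AddCircle (2 * Real.pi) => (fourier 1 x : ℂ)) ⁻¹'
      {Complex.I, -Complex.I}).Finite := (Set.toFinite _).preimage hinj.injOn
  have hv : (volume : Measure (AddCircle (2 * Real.pi))) {x | circleCos x = 0} = 0 := by
    refine measure_mono_null hsub ?_
    rw [← Set.biUnion_of_singleton (_ ⁻¹' _), measure_biUnion_null_iff hfin.countable]
    intro x _
    rw [← Metric.closedBall_zero, AddCircle.volume_closedBall, mul_zero,
      min_eq_right Real.two_pi_pos.le, ENNReal.ofReal_zero]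
  rw [AddCircle.volume_eq_smul_haarAddCircle] at hv
  have hpi : ENNReal.ofReal (2 * Real.pi) ≠ 0 := by
    simpa using Real.two_pi_pos
  rw [Measure.smul_apply, smul_eq_mul] at hv
  exact (mul_eq_zero.1 hv).resolve_left hpi

theorem exists_measure_circleCos_small {ε : ℝ} (hε : 0 < ε) :
    ∃ δ > 0, δ ≤ 1 / 16 ∧ circleHaar {x | |circleCos x| < δ} ≤ ENNReal.ofReal ε := by
  have hmeas : ∀ n : ℕ, MeasurableSet {x | |circleCos x| < 1 / ((n : ℝ) + 1)} := fun n =>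
    measurableSet_lt continuous_circleCos.abs.measurable measurable_const
  have hanti : Antitone fun n : ℕ => {x | |circleCos x| < 1 / ((n : ℝ) + 1)} :=
    by
    intro m n hmn x hx
    exact lt_of_lt_of_le (show |circleCos x| < 1 / ((n : ℝ) + 1) from hx)
      (Nat.one_div_le_one_div hmn)
  have hlim := tendsto_measure_iInter_atTop (μ := circleHaar)
    (fun n => (hmeas n).nullMeasurableSet) hanti ⟨0, measure_ne_top _ _⟩
  have hI : (⋂ n : ℕ, {x | |circleCos x| < 1 / ((n : ℝ) + 1)}) = {x | circleCos x = 0} := by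
    ext x
    simp only [Set.mem_iInter, Set.mem_ofPred_eq]
    constructor
    · intro h
      by_contra hx
      obtain ⟨n, hn⟩ := exists_nat_one_div_lt (abs_pos.2 hx)
      exact lt_asymm hn (h n)
    · intro h n
      rw [h, abs_zero]; positivity
  rw [hI, measure_circleCos_eq_zero] at hlim
  have h1 := hlim.eventually_le_const (ENNReal.ofReal_pos.2 hε)
  obtain ⟨n, hn, hn'⟩ := (h1.and (eventually_ge_atTop 15)).exists
  refine ⟨1 / ((n : ℝ) + 1), by positivity, ?_, hn⟩
  have : (15 : ℝ) ≤ n := by exact_mod_cast hn'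
  apply one_div_le_one_div_of_le <;> linarith

/-- A polynomial that is nearly a step function of the cosine. -/
theorem exists_step_polynomial {ε : ℝ} (hε : 0 < ε) :
    ∃ P : Polynomial ℝ, (∀ t ∈ Set.Icc (-1 : ℝ) 1, P.eval t ∈ Set.Icc (0 : ℝ) 1) ∧
      circleHaar {x | ε < P.eval (circleCos x) ∧ P.eval (circleCos x) < 1 - ε} ≤
        ENNReal.ofReal ε ∧
      1 / 8 ≤ ∫ x, P.eval (circleCos x) * circleCos x ∂circleHaar := by
  obtain ⟨δ, hδ, hδ', hmeas⟩ := exists_measure_circleCos_small hε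
  set h : ℝ → ℝ := fun t => max 0 (min 1 ((t / δ + 1) / 2)) with hh
  have hcont : Continuous h := by fun_prop
  have h0 : ∀ t, 0 ≤ h t := fun t => le_max_left _ _
  have h1 : ∀ t, h t ≤ 1 := fun t => max_le zero_le_one (min_le_left _ _)
  have hpos : ∀ t, δ ≤ t → h t = 1 := by
    intro t ht
    have : 1 ≤ t / δ := (one_le_div hδ).2 ht
    simp only [hh]
    rw [min_eq_left (by linarith), max_eq_right zero_le_one]
  have hneg : ∀ t, t ≤ -δ → h t = 0 := by
    intro t ht
    have : t / δ ≤ -1 := by rw [div_le_iff₀ hδ]; linarith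
    simp only [hh]
    exact max_eq_left ((min_le_right _ _).trans (by linarith))
  set e := min ε (1 / 16) with he
  have he0 : 0 < e := by positivity
  have heε : e ≤ ε := min_le_left _ _
  have he16 : e ≤ 1 / 16 := min_le_right _ _
  obtain ⟨q, hq⟩ := exists_polynomial_near_of_continuousOn (-1) 1 h hcont.continuousOn (e / 4)
    (by positivity)
  have hd : 0 < 1 + e / 2 := by positivity
  set P : Polynomial ℝ := Polynomial.C (1 / (1 + e / 2)) * (q + Polynomial.C (e / 4)) with hP
  have hPe : ∀ t, P.eval t = (q.eval t + e / 4) / (1 + e / 2) := by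
    intro t; simp only [hP, Polynomial.eval_mul, Polynomial.eval_C, Polynomial.eval_add]; ring
  have hP01 : ∀ t ∈ Set.Icc (-1 : ℝ) 1, P.eval t ∈ Set.Icc (0 : ℝ) 1 := by
    intro t ht
    have := abs_lt.1 (hq t ht)
    have := h0 t; have := h1 t
    rw [hPe]
    constructor
    · apply div_nonneg _ hd.le; linarith
    · rw [div_le_one hd]; linarith
  have hPh : ∀ t ∈ Set.Icc (-1 : ℝ) 1, |P.eval t - h t| ≤ e := by
    intro t ht
    have := abs_lt.1 (hq t ht)
    have := h0 t; have := h1 t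
    rw [hPe, abs_le]
    constructor
    · rw [neg_le_sub_iff_le_add, ← sub_le_iff_le_add, le_div_iff₀ hd]; nlinarith
    · rw [sub_le_iff_le_add, div_le_iff₀ hd]; nlinarith
  refine ⟨P, hP01, (measure_mono ?_).trans hmeas, ?_⟩
  · rintro x ⟨hx1, hx2⟩
    by_contra hc
    simp only [Set.mem_ofPred_eq, not_lt] at hc
    have hb := abs_le.1 (hPh _ (circleCos_mem x))
    rcases le_abs.1 hc with hc | hc
    · rw [hpos _ hc] at hb; linarith
    · rw [hneg _ (by linarith)] at hb; linarith
  · have hint : Integrable (fun x => (circleCos x ^ 2 + circleCos x) / 2 - 1 / 8) circleHaar :=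
      integrable_circleHaar
        (by have := continuous_circleCos; fun_prop)
    have hval : ∫ x, ((circleCos x ^ 2 + circleCos x) / 2 - 1 / 8) ∂circleHaar = 1 / 8 := by
      have i1 : Integrable (fun x => circleCos x ^ 2) circleHaar :=
        integrable_circleHaar (continuous_circleCos.pow 2)
      have i2 := integrable_circleHaar continuous_circleCos
      have i3 : Integrable (fun x => (circleCos x ^ 2 + circleCos x) / 2) circleHaar :=
        (i1.add i2).div_const 2
      rw [integral_sub i3 (integrable_const _), integral_div,
        integral_add i1 i2, integral_circleCos_sq, integral_circleCos]
      simp; norm_num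
    rw [← hval]
    refine integral_mono hint (integrable_circleHaar ?_) fun x => ?_
    · exact (P.continuous.comp continuous_circleCos).mul continuous_circleCos
    · obtain ⟨l, u⟩ := circleCos_mem x
      obtain ⟨b1, b2⟩ := abs_le.1 (hPh _ (circleCos_mem x))
      obtain ⟨p1, p2⟩ := hP01 _ (circleCos_mem x)
      have g0 := h0 (circleCos x)
      have g1 := h1 (circleCos x)
      simp only
      generalize circleCos x = c at *
      rcases le_total δ c with hc | hc
      · rw [hpos _ hc] at b1
        nlinarith
      · rcases le_total c (-δ) with hc' | hc'
        · rw [hneg _ hc'] at b2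
          nlinarith
        · nlinarith

theorem integral_re_eq_mean_re (f : C(Torus2, ℂ)) :
    ∫ p, (f p).re ∂torusHaar = (mean f).re := by
  have h := integral_re (integrable_torusHaar f.continuous)
  simpa [mean_def] using h

theorem mean_star (f : C(Torus2, ℂ)) : mean (star f) = star (mean f) := by
  simp only [mean_def]
  exact integral_conj

theorem mean_mul_star_self (f : C(Torus2, ℂ)) :
    (mean (f * star f)).re = ∫ p, ‖f p‖ ^ 2 ∂torusHaar := by
  rw [← integral_re_eq_mean_re]
  congr 1; ext p
  rw [ContinuousMap.mul_apply, ContinuousMap.star_apply, Complex.star_def, Complex.mul_conj,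
    Complex.ofReal_re, Complex.normSq_eq_norm_sq]

theorem norm_convex_weighted_le {θ : ℝ} (h0 : 0 ≤ θ) (h1 : θ ≤ 1) (a b : ℂ) :
    ‖(1 - (θ : ℂ)) * a + θ * b‖ ≤ (1 - θ) * ‖a‖ + θ * ‖b‖ := by
  have e1 : ‖(1 - (θ : ℂ))‖ = 1 - θ := by
    rw [← Complex.ofReal_one, ← Complex.ofReal_sub, Complex.norm_real, Real.norm_of_nonneg]
    linarith
  have e2 : ‖(θ : ℂ)‖ = θ := by rw [Complex.norm_real, Real.norm_of_nonneg h0]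
  refine (norm_add_le _ _).trans_eq ?_
  rw [norm_mul, norm_mul, e1, e2]

theorem norm_sq_convex_le {θ : ℝ} (h0 : 0 ≤ θ) (h1 : θ ≤ 1) (a b : ℂ) :
    ‖(1 - (θ : ℂ)) * a + θ * b‖ ^ 2 ≤ (1 - θ) * ‖a‖ ^ 2 + θ * ‖b‖ ^ 2 := by
  have h := norm_convex_weighted_le h0 h1 a b
  have h2 := pow_le_pow_left₀ (norm_nonneg _) h 2
  refine h2.trans ?_
  nlinarith [mul_nonneg (mul_nonneg h0 (sub_nonneg.2 h1)) (sq_nonneg (‖a‖ - ‖b‖))]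

theorem norm_convex_le {θ : ℝ} (h0 : 0 ≤ θ) (h1 : θ ≤ 1) {a b : ℂ} {c : ℝ} (ha : ‖a‖ ≤ c)
    (hb : ‖b‖ ≤ c) : ‖(1 - (θ : ℂ)) * a + θ * b‖ ≤ c := by
  have h := norm_sq_convex_le h0 h1 a b
  have hc : 0 ≤ c := (norm_nonneg a).trans ha
  have ha' := pow_le_pow_left₀ (norm_nonneg _) ha 2
  have hb' := pow_le_pow_left₀ (norm_nonneg _) hb 2
  refine abs_le_of_sq_le_sq' ?_ hc |>.2
  nlinarith

/-- Adding a slow term and mixing two centred, dilated terms by a slow convex combination increases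
the second moment in a controlled way. -/
theorem eventually_integral_norm_sq_le {U V Φ a b : C(Torus2, ℂ)} {φ : Torus2 → ℝ} {w c v : ℝ}
    (hU : U ∈ trigAlg) (hV : V ∈ trigAlg) (hΦ : Φ ∈ trigAlg) (ha : a ∈ trigAlg) (hb : b ∈ trigAlg)
    (hφ : ∀ p, Φ p = φ p) (h0 : ∀ p, 0 ≤ φ p) (h1 : ∀ p, φ p ≤ 1) (hVc : ∀ p, ‖V p‖ ^ 2 ≤ c)
    (hUw : ∀ p, ‖U p‖ ^ 2 ≤ w) (ma : mean a = 0) (mb : mean b = 0)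
    (va : ∫ p, ‖a p‖ ^ 2 ∂torusHaar ≤ v) (vb : ∫ p, ‖b p‖ ^ 2 ∂torusHaar ≤ v) :
    ∀ᶠ Q : ℕ in atTop,
      ∫ p, ‖(U + V * ((1 - Φ) * dil Q a + Φ * dil Q b)) p‖ ^ 2 ∂torusHaar ≤ w + c * v := by
  have hΦ' : 1 - Φ ∈ trigAlg := sub_mem (one_mem _) hΦ
  filter_upwards [
    eventually_mean_mul_dil (mul_mem hU (star_mem_trigAlg (mul_mem hV hΦ'))) (star_mem_trigAlg ha),
    eventually_mean_mul_dil (mul_mem hU (star_mem_trigAlg (mul_mem hV hΦ))) (star_mem_trigAlg hb),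
    eventually_mean_mul_dil hΦ' (mul_mem ha (star_mem_trigAlg ha)),
    eventually_mean_mul_dil hΦ (mul_mem hb (star_mem_trigAlg hb))] with Q q1 q2 q3 q4
  rw [mean_star, ma, star_zero, mul_zero] at q1
  rw [mean_star, mb, star_zero, mul_zero] at q2
  have hc : 0 ≤ c := (sq_nonneg _).trans (hVc 0)
  set H : C(Torus2, ℂ) := (w : ℂ) • 1 + (2 : ℂ) • (U * star (V * (1 - Φ)) * dil Q (star a) +
    U * star (V * Φ) * dil Q (star b)) +
    (c : ℂ) • ((1 - Φ) * dil Q (a * star a) + Φ * dil Q (b * star b)) with hH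
  have hpt : ∀ p, ‖(U + V * ((1 - Φ) * dil Q a + Φ * dil Q b)) p‖ ^ 2 ≤ (H p).re := by
    intro p
    set A := dil Q a p with hA
    set D := dil Q b p with hD
    have e1 : (U + V * ((1 - Φ) * dil Q a + Φ * dil Q b)) p =
        U p + V p * ((1 - (φ p : ℂ)) * A + φ p * D) := by
      simp [hφ, ← hA, ← hD]
    have e2 : (H p).re = w + 2 * (U p * star (V p * ((1 - (φ p : ℂ)) * A + φ p * D))).re +
        c * ((1 - φ p) * ‖A‖ ^ 2 + φ p * ‖D‖ ^ 2) := by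
      have hAA : A * star A = ((‖A‖ ^ 2 : ℝ) : ℂ) := by
        rw [Complex.star_def, Complex.mul_conj, Complex.normSq_eq_norm_sq]
      have hDD : D * star D = ((‖D‖ ^ 2 : ℝ) : ℂ) := by
        rw [Complex.star_def, Complex.mul_conj, Complex.normSq_eq_norm_sq]
      have : H p = (w : ℂ) + 2 * (U p * star (V p * ((1 - (φ p : ℂ)) * A + φ p * D))) +
          (c : ℂ) * (((1 - φ p : ℝ) : ℂ) * (A * star A) + (φ p : ℂ) * (D * star D)) := by
        simp [hH, hφ, dil_star, ← hA, ← hD]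
        ring
      rw [this, hAA, hDD]
      norm_cast
      simp only [Complex.add_re, Complex.mul_re, Complex.ofReal_re,
        Complex.re_ofNat, Complex.im_ofNat]
      ring
    rw [e1, e2]
    generalize hW : (1 - (φ p : ℂ)) * A + φ p * D = W
    have hWle : ‖W‖ ^ 2 ≤ (1 - φ p) * ‖A‖ ^ 2 + φ p * ‖D‖ ^ 2 := by
      rw [← hW]; exact norm_sq_convex_le (h0 p) (h1 p) A D
    have hsq : ‖U p + V p * W‖ ^ 2 = ‖U p‖ ^ 2 + 2 * (U p * star (V p * W)).re + ‖V p * W‖ ^ 2 := by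
      rw [← Complex.normSq_eq_norm_sq, Complex.normSq_add, Complex.normSq_eq_norm_sq,
        Complex.normSq_eq_norm_sq, Complex.star_def]
      ring
    have hVW : ‖V p * W‖ ^ 2 ≤ c * ‖W‖ ^ 2 := by
      rw [norm_mul, mul_pow]
      exact mul_le_mul_of_nonneg_right (hVc p) (sq_nonneg _)
    have := hUw p
    have := mul_le_mul_of_nonneg_left hWle hc
    rw [hsq]; linarith
  have hint : ∫ p, ‖(U + V * ((1 - Φ) * dil Q a + Φ * dil Q b)) p‖ ^ 2 ∂torusHaar ≤
      (mean H).re := by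
    rw [← integral_re_eq_mean_re]
    refine integral_mono (integrable_torusHaar ?_) (integrable_torusHaar ?_) hpt
    · exact (ContinuousMap.continuous _).norm.pow 2
    · exact Complex.continuous_re.comp H.continuous
  refine hint.trans ?_
  set θ := ∫ p, φ p ∂torusHaar with hθ
  have hφr : φ = fun p => (Φ p).re := by ext p; rw [hφ]; simp
  have hφi : Integrable φ torusHaar := by
    rw [hφr]; exact integrable_torusHaar (Complex.continuous_re.comp Φ.continuous)
  have mΦ : mean Φ = (θ : ℂ) := by
    rw [mean_def, hθ, ← integral_complex_ofReal]; simp_rw [hφ]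
  have hθ0 : 0 ≤ θ := integral_nonneg h0
  have hθ1 : θ ≤ 1 := by
    have := integral_mono hφi (integrable_const 1) h1
    simpa using this
  have hre : (mean H).re = w + c * ((1 - θ) * (∫ p, ‖a p‖ ^ 2 ∂torusHaar) +
      θ * ∫ p, ‖b p‖ ^ 2 ∂torusHaar) := by
    rw [hH, map_add, map_add, map_smul, map_smul, map_smul, map_add, map_add, q1, q2, q3, q4,
      map_sub, mean_one, mΦ, ← mean_mul_star_self, ← mean_mul_star_self]
    simp
  rw [hre]
  have := mul_le_mul_of_nonneg_left va (sub_nonneg.2 hθ1)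
  have := mul_le_mul_of_nonneg_left vb hθ0
  have h3 : (1 - θ) * (∫ p, ‖a p‖ ^ 2 ∂torusHaar) + θ * ∫ p, ‖b p‖ ^ 2 ∂torusHaar ≤ v := by
    nlinarith
  have := mul_le_mul_of_nonneg_left h3 hc
  linarith

/-- The cosine of the character with frequency `m`. -/
noncomputable def cosC (m : ℤ × ℤ) : C(Torus2, ℂ) := (1 / 2 : ℂ) • (expoC m + expoC (-m))

theorem cosC_apply (m : ℤ × ℤ) (p : Torus2) : cosC m p = (circleCos (freqHom m p) : ℂ) := by
  have h : expoC (-m) p = star (expoC m p) := by rw [← star_expoC]; rfl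
  rw [cosC, ContinuousMap.smul_apply, ContinuousMap.add_apply, h, Complex.star_def,
    Complex.add_conj, circleCos, ← expoC_eq_fourier_freqHom, smul_eq_mul]
  push_cast; ring

theorem cosC_mem (m : ℤ × ℤ) : cosC m ∈ trigAlg :=
  Subalgebra.smul_mem _ (add_mem (expoC_mem_trigAlg _) (expoC_mem_trigAlg _)) _

/-- A real polynomial in the cosine of the character with frequency `m`. -/
noncomputable def stepC (P : Polynomial ℝ) (m : ℤ × ℤ) : C(Torus2, ℂ) :=
  Polynomial.aeval (cosC m) (P.map (algebraMap ℝ ℂ))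

theorem stepC_apply (P : Polynomial ℝ) (m : ℤ × ℤ) (p : Torus2) :
    stepC P m p = ((P.eval (circleCos (freqHom m p)) : ℝ) : ℂ) := by
  rw [stepC, Polynomial.aeval_continuousMap_apply, cosC_apply, Polynomial.eval_map_algebraMap]
  exact Polynomial.aeval_algebraMap_apply_eq_algebraMap_eval _ _

theorem stepC_mem (P : Polynomial ℝ) (m : ℤ × ℤ) : stepC P m ∈ trigAlg :=
  Algebra.adjoin_le (Set.singleton_subset_iff.2 (cosC_mem m))
    (Polynomial.aeval_mem_adjoin_singleton ℂ (cosC m))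

/-- The factor `1 + i β cos` of a Riesz product. -/
noncomputable def rieszC (β : ℝ) (m : ℤ × ℤ) : C(Torus2, ℂ) := 1 + (Complex.I * β) • cosC m

theorem rieszC_mem (β : ℝ) (m : ℤ × ℤ) : rieszC β m ∈ trigAlg :=
  add_mem (one_mem _) (Subalgebra.smul_mem _ (cosC_mem m) _)

theorem norm_sq_rieszC_le (β : ℝ) (m : ℤ × ℤ) (p : Torus2) : ‖rieszC β m p‖ ^ 2 ≤ 1 + β ^ 2 := by
  obtain ⟨h1, h2⟩ := circleCos_mem (freqHom m p)
  have e : rieszC β m p = ((1 : ℝ) : ℂ) + ((β * circleCos (freqHom m p) : ℝ) : ℂ) * Complex.I := by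
    simp [rieszC, cosC_apply]; ring
  rw [e, Complex.sq_norm, Complex.normSq_add_mul_I]
  have : circleCos (freqHom m p) ^ 2 ≤ 1 := by nlinarith
  nlinarith [sq_nonneg β]

theorem norm_rieszC_le {β : ℝ} (h0 : 0 ≤ β) (h1 : β ≤ 1) (m : ℤ × ℤ) (p : Torus2) :
    ‖rieszC β m p‖ ≤ 2 := by
  have := norm_sq_rieszC_le β m p
  nlinarith [norm_nonneg (rieszC β m p)]

theorem norm_cosC_le (m : ℤ × ℤ) (p : Torus2) : ‖cosC m p‖ ≤ 1 := by
  rw [cosC_apply, Complex.norm_real]; exact abs_le.2 (circleCos_mem _)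

theorem mean_cosC {m : ℤ × ℤ} (hm : m ≠ 0) : mean (cosC m) = 0 := by
  rw [cosC, map_smul, map_add, mean_expoC, mean_expoC, if_neg hm, if_neg (neg_ne_zero.2 hm)]
  simp

/-- The first Fourier coefficient of a polynomial in the cosine. -/
noncomputable def stepCoeff (P : Polynomial ℝ) : ℂ :=
  ∫ x, ((P.eval (circleCos x) : ℝ) : ℂ) * fourier 1 x ∂circleHaar

theorem continuous_eval_circleCos_mul (P : Polynomial ℝ) :
    Continuous fun x => ((P.eval (circleCos x) : ℝ) : ℂ) * fourier 1 x :=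
  (Complex.continuous_ofReal.comp (P.continuous.comp continuous_circleCos)).mul
    (fourier 1).continuous

theorem mean_stepC_mul_expoC (P : Polynomial ℝ) {m : ℤ × ℤ} (hm : m.1 ≠ 0) :
    mean (stepC P m * expoC m) = stepCoeff P := by
  have hmp := measurePreserving_freqHom hm
  rw [stepCoeff, circleHaar, ← hmp.map_eq, integral_map hmp.measurable.aemeasurable
    (continuous_eval_circleCos_mul P).aestronglyMeasurable, mean_def]
  simp only [ContinuousMap.mul_apply, stepC_apply, expoC_eq_fourier_freqHom]

theorem stepCoeff_re (P : Polynomial ℝ) :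
    (stepCoeff P).re = ∫ x, P.eval (circleCos x) * circleCos x ∂circleHaar := by
  have hi : Integrable (fun x => ((P.eval (circleCos x) : ℝ) : ℂ) * fourier 1 x) circleHaar :=
    (continuous_eval_circleCos_mul P).integrable_of_hasCompactSupport
      (HasCompactSupport.of_compactSpace _)
  have h := integral_re hi
  rw [stepCoeff]
  refine h.symm.trans ?_
  simp [circleCos]

theorem norm_stepCoeff_le {P : Polynomial ℝ}
    (hP : ∀ t ∈ Set.Icc (-1 : ℝ) 1, P.eval t ∈ Set.Icc (0 : ℝ) 1) : ‖stepCoeff P‖ ≤ 1 := by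
  have h := norm_integral_le_of_norm_le_const (μ := circleHaar) (C := 1)
    (f := fun x => ((P.eval (circleCos x) : ℝ) : ℂ) * fourier 1 x) (ae_of_all _ fun x => by
      obtain ⟨h1, h2⟩ := hP _ (circleCos_mem x)
      rw [norm_mul, norm_fourier_one, mul_one, Complex.norm_real, Real.norm_of_nonneg h1]
      exact h2)
  simpa [stepCoeff] using h

/-- The frequencies opposite to those of `slopeCone s t`. -/
def negCone (s t : ℝ) : Set (ℤ × ℤ) := {k | -k ∈ slopeCone s t}

theorem absorbing_negCone (s t : ℝ) : Absorbing (negCone s t) := (absorbing_slopeCone s t).neg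

theorem negCone_mono {s s' t t' : ℝ} (hs : s' ≤ s) (ht : t ≤ t') : negCone s t ⊆ negCone s' t' :=
  fun _ hk => slopeCone_mono hs ht hk

/-- A polynomial whose values at cosines lie in `[0, 1]`, within `ε` of `{0, 1}` outside a set of
measure `ε`. -/
structure IsStep (P : Polynomial ℝ) (ε : ℝ) : Prop where
  mem : ∀ t ∈ Set.Icc (-1 : ℝ) 1, P.eval t ∈ Set.Icc (0 : ℝ) 1
  meas : circleHaar {x | ε < P.eval (circleCos x) ∧ P.eval (circleCos x) < 1 - ε} ≤
    ENNReal.ofReal ε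

/-- A bounded trigonometric polynomial `G` with frequencies in a cone of slopes, together with a
polynomial `A` of controlled mean and variance that, outside a small set, is approximated at each
point by one of the parts `I τ` of `G` with slopes greater than `τ`. -/
structure ConeData (β ε B : ℝ) (κ : ℂ) (n : ℕ) (s t : ℝ) where
  T : Finset ℝ
  G : C(Torus2, ℂ)
  Gp : C(Torus2, ℂ)
  A : C(Torus2, ℂ)
  I : ℝ → C(Torus2, ℂ)
  mem_T : ∀ τ ∈ T, s < τ ∧ τ < t
  Gp_mem : Gp ∈ trigPoly (slopeCone s t)
  Gn_mem : G - 1 - Gp ∈ trigPoly (negCone s t)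
  A_mem : A ∈ trigAlg
  I_mem : ∀ τ ∈ T, I τ ∈ trigPoly (slopeCone τ t)
  J_mem : ∀ τ ∈ T, G - 1 - I τ ∈ trigPoly (slopeCone s τ ∪ negCone s t)
  G_le : ∀ p, ‖G p‖ ^ 2 ≤ (1 + β ^ 2) ^ n
  A_le : ∀ p, ‖A p‖ ≤ 3 ^ n
  Gp_le : ∀ p, ‖Gp p‖ ≤ 3 ^ n
  A_mean : mean A = Complex.I * β * κ / 2 * n
  A_var : ∫ p, ‖(A - algebraMap ℂ _ (mean A)) p‖ ^ 2 ∂torusHaar ≤ n * B * (1 + β ^ 2) ^ n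
  bad : torusHaar {p | ∀ τ ∈ T, 8 ^ n * ε < ‖I τ p - A p‖} ≤ ENNReal.ofReal ((2 ^ n - 1) * ε)

/-- The trivial instance, with `G = 1`. -/
noncomputable def ConeData.zero {β ε B : ℝ} {κ : ℂ} {s t : ℝ} (hε : 0 ≤ ε) (hst : s < t) :
    ConeData β ε B κ 0 s t where
  T := {(s + t) / 2}
  G := 1
  Gp := 0
  A := 0
  I _ := 0
  mem_T τ hτ := by rw [Finset.mem_singleton.1 hτ]; constructor <;> linarith
  Gp_mem := zero_mem _
  Gn_mem := by simp
  A_mem := zero_mem _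
  I_mem _ _ := zero_mem _
  J_mem _ _ := by simp
  G_le p := by simp
  A_le p := by simp
  Gp_le p := by simp
  A_mean := by simp
  A_var := by simp
  bad := by
    have : {p : Torus2 | ∀ τ ∈ ({(s + t) / 2} : Finset ℝ),
        8 ^ 0 * ε < ‖(0 : C(Torus2, ℂ)) p - (0 : C(Torus2, ℂ)) p‖} = ∅ := by
      ext p; simp [hε]
    rw [this]; simp

theorem exists_frequency_of_slope (q : ℚ) :
    ∃ m : ℤ × ℤ, 0 < m.1 ∧ ∀ s t : ℝ, (s < q → q < t → m ∈ slopeCone s t) := by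
  have h0 : (0 : ℝ) < q.den := by exact_mod_cast q.den_pos
  have h1 : (0 : ℤ) < q.den := by exact_mod_cast q.den_pos
  refine ⟨(q.den, -q.num), h1, fun s t hs ht => ⟨h1, ?_, ?_⟩⟩
  all_goals
    have hq : (q : ℝ) * q.den = q.num := by exact_mod_cast Rat.mul_den_eq_num q
    push_cast
    nlinarith

theorem norm_mix_le {V a b : ℂ} {φ c : ℝ} (hV : ‖V‖ ≤ 2) (h0 : 0 ≤ φ) (h1 : φ ≤ 1)
    (ha : ‖a‖ ≤ c) (hb : ‖b‖ ≤ c) : ‖V * ((1 - (φ : ℂ)) * a + φ * b)‖ ≤ 2 * c := by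
  rw [norm_mul]
  exact mul_le_mul hV (norm_convex_le h0 h1 ha hb) (norm_nonneg _) zero_le_two

theorem norm_node_le {β : ℝ} (h0 : 0 ≤ β) (h1 : β ≤ 1) (z : ℂ) :
    ‖Complex.I * β / 2 * z‖ ≤ ‖z‖ / 2 := by
  rw [norm_mul, norm_div, norm_mul, Complex.norm_I, Complex.norm_real, Real.norm_of_nonneg h0,
    one_mul, Complex.norm_ofNat]
  nlinarith [norm_nonneg z]

/-- If the mixing weight is nearly `0`, dropping the second branch is a small error. -/
theorem norm_drop_right_le {β ε φ C e : ℝ} {V z i a b : ℂ} (hβ0 : 0 ≤ β) (hβ1 : β ≤ 1)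
    (hV : ‖V‖ ≤ 2) (h0 : 0 ≤ φ) (h1 : φ ≤ 1) (hφ : φ ≤ ε) (hz : ‖z‖ ≤ 1) (hi : ‖i - a‖ ≤ e)
    (hb : ‖b‖ ≤ C) :
    ‖V * (1 - φ) * i - (Complex.I * β / 2 * (φ * z) + V * ((1 - φ) * a + φ * b))‖ ≤
      ε / 2 + 2 * (e + ε * C) := by
  have hφn : ‖(φ : ℂ)‖ = φ := by rw [Complex.norm_real, Real.norm_of_nonneg h0]
  have e1 : V * (1 - φ) * i - (Complex.I * β / 2 * (φ * z) + V * ((1 - φ) * a + φ * b)) =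
      V * ((1 - φ) * (i - a) + φ * (-b)) - Complex.I * β / 2 * (φ * z) := by ring
  rw [e1]
  have h3 : ‖Complex.I * β / 2 * (φ * z)‖ ≤ ε / 2 := by
    refine (norm_node_le hβ0 hβ1 _).trans ?_
    rw [norm_mul, hφn]
    nlinarith [norm_nonneg z]
  have he : 0 ≤ e := (norm_nonneg _).trans hi
  have hC : 0 ≤ C := (norm_nonneg _).trans hb
  have h4 : ‖V * ((1 - φ) * (i - a) + φ * (-b))‖ ≤ 2 * (e + ε * C) := by
    rw [norm_mul]
    refine mul_le_mul hV ((norm_convex_weighted_le h0 h1 _ _).trans ?_) (norm_nonneg _) zero_le_two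
    rw [norm_neg]
    have : (1 - φ) * ‖i - a‖ ≤ 1 * e := mul_le_mul (by linarith) hi (norm_nonneg _) zero_le_one
    have : φ * ‖b‖ ≤ ε * C := mul_le_mul hφ hb (norm_nonneg _) (h0.trans hφ)
    linarith
  exact (norm_sub_le _ _).trans (by linarith)

/-- If the mixing weight is nearly `1`, perturbing the first branch is a small error. -/
theorem norm_drop_left_le {β ε φ C e : ℝ} {V z g i a b : ℂ} (hβ0 : 0 ≤ β) (hβ1 : β ≤ 1)
    (hV : ‖V‖ ≤ 2) (h0 : 0 ≤ φ) (h1 : φ ≤ 1) (hφ : 1 - ε ≤ φ) (hz : ‖z‖ ≤ 1) (hi : ‖i - b‖ ≤ e)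
    (ha : ‖a‖ ≤ C) (hg : ‖g‖ ≤ C) :
    ‖Complex.I * β / 2 * z + V * (1 - φ) * g + V * φ * i -
      (Complex.I * β / 2 * (φ * z) + V * ((1 - φ) * a + φ * b))‖ ≤
      ε / 2 + 2 * (e + ε * (2 * C)) := by
  have hφn : ‖(1 - φ : ℂ)‖ = 1 - φ := by
    rw [← Complex.ofReal_one, ← Complex.ofReal_sub, Complex.norm_real, Real.norm_of_nonneg]
    linarith
  have e1 : Complex.I * β / 2 * z + V * (1 - φ) * g + V * φ * i -
      (Complex.I * β / 2 * (φ * z) + V * ((1 - φ) * a + φ * b)) =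
      V * ((1 - φ) * (g - a) + φ * (i - b)) + Complex.I * β / 2 * ((1 - φ) * z) := by ring
  rw [e1]
  have h3 : ‖Complex.I * β / 2 * ((1 - φ) * z)‖ ≤ ε / 2 := by
    refine (norm_node_le hβ0 hβ1 _).trans ?_
    rw [norm_mul, hφn]
    nlinarith [norm_nonneg z]
  have he : 0 ≤ e := (norm_nonneg _).trans hi
  have hC : 0 ≤ C := (norm_nonneg _).trans ha
  have hga : ‖g - a‖ ≤ 2 * C := (norm_sub_le _ _).trans (by linarith)
  have h4 : ‖V * ((1 - φ) * (g - a) + φ * (i - b))‖ ≤ 2 * (e + ε * (2 * C)) := by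
    rw [norm_mul]
    refine mul_le_mul hV ((norm_convex_weighted_le h0 h1 _ _).trans ?_) (norm_nonneg _) zero_le_two
    have : φ * ‖i - b‖ ≤ 1 * e := mul_le_mul h1 hi (norm_nonneg _) zero_le_one
    have : (1 - φ) * ‖g - a‖ ≤ ε * (2 * C) :=
      mul_le_mul (by linarith) hga (norm_nonneg _) (by linarith)
    linarith
  exact (norm_add_le _ _).trans (by linarith)

theorem branch_error_le (ε : ℝ) (hε : 0 ≤ ε) (n : ℕ) :
    ε / 2 + 2 * (8 ^ n * ε + ε * (2 * 3 ^ n)) ≤ 8 ^ (n + 1) * ε := by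
  have h1 : (3 : ℝ) ^ n ≤ 8 ^ n := pow_le_pow_left₀ (by norm_num) (by norm_num) n
  have h2 : (1 : ℝ) ≤ 8 ^ n := one_le_pow₀ (by norm_num)
  rw [pow_succ]
  nlinarith

theorem ConeData.nonempty_succ {β ε B : ℝ} {P : Polynomial ℝ} {n : ℕ} (hβ0 : 0 ≤ β) (hβ1 : β ≤ 1)
    (hε : 0 ≤ ε) (hP : IsStep P ε) (hB : β ^ 2 * (1 + n * β) ^ 2 ≤ B)
    (ih : ∀ s t : ℝ, s < t → Nonempty (ConeData β ε B (stepCoeff P) n s t)) {s t : ℝ}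
    (hst : s < t) : Nonempty (ConeData β ε B (stepCoeff P) (n + 1) s t) := by
  obtain ⟨r, hsr, hrt⟩ := exists_rat_btwn hst
  obtain ⟨m, hm, hmc⟩ := exists_frequency_of_slope r
  obtain ⟨L⟩ := ih r t hrt
  obtain ⟨R⟩ := ih s r hsr
  have hm0 : m ≠ 0 := by rintro rfl; exact lt_irrefl _ hm
  set V := rieszC β m with hV
  set Φ := stepC P m with hΦ
  set φ : Torus2 → ℝ := fun p => P.eval (circleCos (freqHom m p)) with hφ
  have hφΦ : ∀ p, Φ p = φ p := fun p => stepC_apply P m p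
  have hφ0 : ∀ p, 0 ≤ φ p := fun p => (hP.mem _ (circleCos_mem _)).1
  have hφ1 : ∀ p, φ p ≤ 1 := fun p => (hP.mem _ (circleCos_mem _)).2
  have hVm : V ∈ trigAlg := rieszC_mem β m
  have hΦm : Φ ∈ trigAlg := stepC_mem P m
  have hΦm' : 1 - Φ ∈ trigAlg := sub_mem (one_mem _) hΦm
  have hu1 : V * (1 - Φ) ∈ trigAlg := mul_mem hVm hΦm'
  have hu2 : V * Φ ∈ trigAlg := mul_mem hVm hΦm
  have hV2 : ∀ p, ‖V p‖ ≤ 2 := norm_rieszC_le hβ0 hβ1 m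
  set c : ℂ := Complex.I * β / 2 with hc
  set μ : ℂ := c * stepCoeff P * n with hμ
  have hμL : mean L.A = μ := by rw [L.A_mean, hμ, hc]; ring
  have hμR : mean R.A = μ := by rw [R.A_mean, hμ, hc]; ring
  have hκ := norm_stepCoeff_le hP.mem
  have hμn : ‖μ‖ ≤ n * β := by
    rw [hμ, hc, norm_mul, norm_mul, norm_div, norm_mul, Complex.norm_I, Complex.norm_real,
      Real.norm_of_nonneg hβ0, one_mul, Complex.norm_ofNat, Complex.norm_natCast]
    have : β / 2 * ‖stepCoeff P‖ ≤ β * 1 :=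
      mul_le_mul (by linarith) hκ (norm_nonneg _) hβ0
    nlinarith [Nat.cast_nonneg (α := ℝ) n]
  set a : C(Torus2, ℂ) := L.A - algebraMap ℂ _ μ with ha
  set b : C(Torus2, ℂ) := R.A - algebraMap ℂ _ μ with hb
  have hma : mean a = 0 := by
    rw [ha, map_sub, hμL, Algebra.algebraMap_eq_smul_one, map_smul, mean_one]; simp
  have hmb : mean b = 0 := by
    rw [hb, map_sub, hμR, Algebra.algebraMap_eq_smul_one, map_smul, mean_one]; simp
  have ham : a ∈ trigAlg := sub_mem L.A_mem (Subalgebra.algebraMap_mem _ _)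
  have hbm : b ∈ trigAlg := sub_mem R.A_mem (Subalgebra.algebraMap_mem _ _)
  set U : C(Torus2, ℂ) := c • (Φ * expoC m - algebraMap ℂ _ (stepCoeff P)) +
    ((Complex.I * β) * μ) • cosC m with hU
  have hUm : U ∈ trigAlg := add_mem (Subalgebra.smul_mem _ (sub_mem (mul_mem hΦm
    (expoC_mem_trigAlg m)) (Subalgebra.algebraMap_mem _ _)) _) (Subalgebra.smul_mem _ (cosC_mem m) _)
  have hUw : ∀ p, ‖U p‖ ^ 2 ≤ B := by
    intro p
    have h1 : ‖U p‖ ≤ β * (1 + n * β) := by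
      have e : U p = c * ((φ p : ℂ) * expoC m p - stepCoeff P) + (Complex.I * β) * μ * cosC m p := by
        simp [hU, hφΦ]
      have f1 : ‖(φ p : ℂ) * expoC m p - stepCoeff P‖ ≤ 2 := by
        refine (norm_sub_le _ _).trans ?_
        rw [norm_mul, norm_expoC_apply, Complex.norm_real, Real.norm_of_nonneg (hφ0 p)]
        linarith [hφ1 p]
      have f2 : ‖c‖ = β / 2 := by
        rw [hc, norm_div, norm_mul, Complex.norm_I, Complex.norm_real,
          Real.norm_of_nonneg hβ0, one_mul, Complex.norm_ofNat]
      have f3 : ‖Complex.I * β * μ * cosC m p‖ ≤ β * (n * β) := by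
        rw [norm_mul, norm_mul, norm_mul, Complex.norm_I, Complex.norm_real,
          Real.norm_of_nonneg hβ0, one_mul]
        have := norm_cosC_le m p
        have h5 : β * ‖μ‖ ≤ β * (n * β) := mul_le_mul_of_nonneg_left hμn hβ0
        nlinarith [mul_nonneg hβ0 (norm_nonneg μ), norm_nonneg (cosC m p)]
      rw [e]
      refine (norm_add_le _ _).trans ?_
      rw [norm_mul c, f2]
      nlinarith [norm_nonneg ((φ p : ℂ) * expoC m p - stepCoeff P)]
    calc ‖U p‖ ^ 2 ≤ (β * (1 + n * β)) ^ 2 := pow_le_pow_left₀ (norm_nonneg _) h1 2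
      _ ≤ B := by rw [mul_pow]; exact hB
  have hvar := eventually_integral_norm_sq_le (v := n * B * (1 + β ^ 2) ^ n) hUm hVm hΦm ham hbm
    hφΦ hφ0 hφ1 (norm_sq_rieszC_le β m) hUw hma hmb (by rw [ha, ← hμL]; exact L.A_var)
    (by rw [hb, ← hμR]; exact R.A_var)
  have hTL : ∀ᶠ Q : ℕ in atTop, ∀ τ ∈ L.T, V * (1 - Φ) * dil Q (L.I τ) ∈ trigPoly (slopeCone τ t) ∧
      V * (1 - Φ) * dil Q (L.G - 1 - L.I τ) ∈ trigPoly (slopeCone r τ ∪ negCone r t) := by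
    rw [eventually_all_finset]
    exact fun τ hτ => ((absorbing_slopeCone _ _).eventually_mul_dil_mem hu1 (L.I_mem τ hτ)).and
      (((absorbing_slopeCone _ _).union (absorbing_negCone _ _)).eventually_mul_dil_mem hu1
        (L.J_mem τ hτ))
  have hTR : ∀ᶠ Q : ℕ in atTop, ∀ τ ∈ R.T, V * Φ * dil Q (R.I τ) ∈ trigPoly (slopeCone τ r) ∧
      V * Φ * dil Q (R.G - 1 - R.I τ) ∈ trigPoly (slopeCone s τ ∪ negCone s r) := by
    rw [eventually_all_finset]
    exact fun τ hτ => ((absorbing_slopeCone _ _).eventually_mul_dil_mem hu2 (R.I_mem τ hτ)).and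
      (((absorbing_slopeCone _ _).union (absorbing_negCone _ _)).eventually_mul_dil_mem hu2
        (R.J_mem τ hτ))
  obtain ⟨Q, qvar, qTL, qTR, q1, q2, q3, q4, q5, q6, q0⟩ := (hvar.and (hTL.and (hTR.and (
    ((absorbing_slopeCone _ _).eventually_mul_dil_mem hu1 L.Gp_mem).and (
    ((absorbing_slopeCone _ _).eventually_mul_dil_mem hu2 R.Gp_mem).and (
    ((absorbing_negCone _ _).eventually_mul_dil_mem hu1 L.Gn_mem).and (
    ((absorbing_negCone _ _).eventually_mul_dil_mem hu2 R.Gn_mem).and (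
    (eventually_mean_mul_dil hu1 ham).and ((eventually_mean_mul_dil hu2 hbm).and
    (eventually_ge_atTop 1)))))))))).exists
  have hVe : V = 1 + c • (expoC m + expoC (-m)) := by
    rw [hV, rieszC, cosC, smul_smul, hc]
    congr 2
    ring
  have hmL : expoC m ∈ trigPoly (slopeCone s t) := expoC_mem (hmc s t hsr hrt)
  have hmN : expoC (-m) ∈ trigPoly (negCone s t) :=
    expoC_mem (show - -m ∈ slopeCone s t by rw [neg_neg]; exact hmc s t hsr hrt)
  have hsr' : s ≤ r := hsr.le
  have hrt' : (r : ℝ) ≤ t := hrt.le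
  set A' : C(Torus2, ℂ) := c • (Φ * expoC m) + V * ((1 - Φ) * dil Q L.A + Φ * dil Q R.A) with hA'
  set G' : C(Torus2, ℂ) := V * ((1 - Φ) * dil Q L.G + Φ * dil Q R.G) with hG'
  set I' : ℝ → C(Torus2, ℂ) := fun τ => if (r : ℝ) < τ then V * (1 - Φ) * dil Q (L.I τ) else
    c • expoC m + V * (1 - Φ) * dil Q L.Gp + V * Φ * dil Q (R.I τ) with hI'
  have hdilμ : dil Q (algebraMap ℂ C(Torus2, ℂ) μ) = algebraMap ℂ _ μ := AlgHom.commutes _ _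
  have halg : ∀ (z : ℂ) (p : Torus2), algebraMap ℂ C(Torus2, ℂ) z p = z := fun _ _ => rfl
  have hA'U : A' = algebraMap ℂ _ (c * stepCoeff P + μ) +
      (U + V * ((1 - Φ) * dil Q a + Φ * dil Q b)) := by
    rw [hA', hU, ha, hb, map_sub, map_sub, hdilμ]
    ext p
    simp only [ContinuousMap.add_apply, ContinuousMap.mul_apply, ContinuousMap.sub_apply,
      ContinuousMap.smul_apply, ContinuousMap.one_apply, halg, smul_eq_mul, hV, rieszC]
    ring
  have hmU : mean U = 0 := by
    rw [hU, map_add, map_smul, map_smul, mean_cosC hm0, map_sub, hΦ,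
      mean_stepC_mul_expoC P hm.ne', Algebra.algebraMap_eq_smul_one, map_smul, mean_one]
    simp
  have hA'mean : mean A' = c * stepCoeff P + μ := by
    have e : V * ((1 - Φ) * dil Q a + Φ * dil Q b) =
      V * (1 - Φ) * dil Q a + V * Φ * dil Q b := by ring
    rw [hA'U, map_add mean, map_add mean, hmU, e, map_add mean, q5, q6, hma, hmb,
      Algebra.algebraMap_eq_smul_one, map_smul, mean_one]
    simp
  have hI'L : ∀ τ ∈ L.T, I' τ = V * (1 - Φ) * dil Q (L.I τ) := fun τ hτ =>
    if_pos (L.mem_T τ hτ).1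
  have hI'R : ∀ τ ∈ R.T, I' τ = c • expoC m + V * (1 - Φ) * dil Q L.Gp + V * Φ * dil Q (R.I τ) :=
    fun τ hτ => if_neg (not_lt.2 (R.mem_T τ hτ).2.le)
  have hG1 : ∀ X Y : C(Torus2, ℂ), G' - 1 = c • (expoC m + expoC (-m)) +
      (V * (1 - Φ) * dil Q (L.G - 1 - X) + V * (1 - Φ) * dil Q X) +
      (V * Φ * dil Q (R.G - 1 - Y) + V * Φ * dil Q Y) := by
    intro X Y
    have e : G' = V + V * (1 - Φ) * dil Q (L.G - 1) + V * Φ * dil Q (R.G - 1) := by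
      rw [hG', map_sub, map_sub, map_one]; ring
    have e2 : V - 1 = c • (expoC m + expoC (-m)) := by rw [hVe]; ring
    rw [e, ← e2, map_sub _ (L.G - 1), map_sub _ (R.G - 1)]
    ring
  have hle : ∀ {S S' : Set (ℤ × ℤ)} {u : C(Torus2, ℂ)}, S ⊆ S' → u ∈ trigPoly S →
    u ∈ trigPoly S' := fun h hu => trigPoly_mono h hu
  refine ⟨{
    T := L.T ∪ R.T
    G := G'
    Gp := c • expoC m + V * (1 - Φ) * dil Q L.Gp + V * Φ * dil Q R.Gp
    A := A'
    I := I'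
    mem_T := ?_
    Gp_mem := ?_
    Gn_mem := ?_
    A_mem := ?_
    I_mem := ?_
    J_mem := ?_
    G_le := ?_
    A_le := ?_
    Gp_le := ?_
    A_mean := ?_
    A_var := ?_
    bad := ?_ }⟩
  · intro τ hτ
    rcases Finset.mem_union.1 hτ with h | h
    · exact ⟨hsr.trans (L.mem_T τ h).1, (L.mem_T τ h).2⟩
    · exact ⟨(R.mem_T τ h).1, (R.mem_T τ h).2.trans hrt⟩
  · exact add_mem (add_mem (Submodule.smul_mem _ _ hmL) (hle (slopeCone_mono hsr' le_rfl) q1))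
      (hle (slopeCone_mono le_rfl hrt') q2)
  · have e : G' - 1 - (c • expoC m + V * (1 - Φ) * dil Q L.Gp + V * Φ * dil Q R.Gp) =
        c • expoC (-m) + V * (1 - Φ) * dil Q (L.G - 1 - L.Gp) +
          V * Φ * dil Q (R.G - 1 - R.Gp) := by
      rw [hG1 L.Gp R.Gp, smul_add]; abel
    rw [e]
    exact add_mem (add_mem (Submodule.smul_mem _ _ hmN) (hle (negCone_mono hsr' le_rfl) q3))
      (hle (negCone_mono le_rfl hrt') q4)
  · exact add_mem (Subalgebra.smul_mem _ (mul_mem hΦm (expoC_mem_trigAlg m)) _)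
      (mul_mem hVm (add_mem (mul_mem hΦm' (dil_mem_trigAlg Q L.A_mem))
        (mul_mem hΦm (dil_mem_trigAlg Q R.A_mem))))
  · intro τ hτ
    rcases Finset.mem_union.1 hτ with h | h
    · rw [hI'L τ h]; exact (qTL τ h).1
    · rw [hI'R τ h]
      have h2 := R.mem_T τ h
      exact add_mem (add_mem (Submodule.smul_mem _ _ (expoC_mem (hmc _ _ h2.2 hrt)))
        (hle (slopeCone_mono h2.2.le le_rfl) q1)) (hle (slopeCone_mono le_rfl hrt') (qTR τ h).1)
  · intro τ hτ
    rcases Finset.mem_union.1 hτ with h | h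
    · have h2 := L.mem_T τ h
      have e : G' - 1 - I' τ = c • expoC m + c • expoC (-m) +
          V * (1 - Φ) * dil Q (L.G - 1 - L.I τ) +
          (V * Φ * dil Q (R.G - 1 - R.Gp) + V * Φ * dil Q R.Gp) := by
        rw [hI'L τ h, hG1 (L.I τ) R.Gp, smul_add]; abel
      rw [e]
      refine add_mem (add_mem (add_mem ?_ ?_) ?_) (add_mem ?_ ?_)
      · exact Submodule.smul_mem _ _ (expoC_mem (Or.inl (hmc _ _ hsr h2.1)))
      · exact Submodule.smul_mem _ _ (hle Set.subset_union_right hmN)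
      · exact hle (Set.union_subset_union (slopeCone_mono hsr' le_rfl) (negCone_mono hsr' le_rfl))
          (qTL τ h).2
      · exact hle ((negCone_mono le_rfl hrt').trans Set.subset_union_right) q4
      · exact hle ((slopeCone_mono le_rfl h2.1.le).trans Set.subset_union_left) q2
    · have e : G' - 1 - I' τ = c • expoC (-m) + V * (1 - Φ) * dil Q (L.G - 1 - L.Gp) +
          V * Φ * dil Q (R.G - 1 - R.I τ) := by
        rw [hI'R τ h, hG1 L.Gp (R.I τ), smul_add]; abel
      rw [e]
      refine add_mem (add_mem ?_ ?_) ?_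
      · exact Submodule.smul_mem _ _ (hle Set.subset_union_right hmN)
      · exact hle ((negCone_mono hsr' le_rfl).trans Set.subset_union_right) q3
      · exact hle (Set.union_subset_union subset_rfl (negCone_mono le_rfl hrt')) (qTR τ h).2
  · intro p
    have e : G' p = V p * ((1 - (φ p : ℂ)) * L.G (Q • p) + φ p * R.G (Q • p)) := by
      simp [hG', hφΦ, dil_apply]
    rw [e, norm_mul, mul_pow, pow_succ (1 + β ^ 2), mul_comm (_ ^ n)]
    refine mul_le_mul (norm_sq_rieszC_le β m p) ?_ (sq_nonneg _) (by positivity)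
    refine (norm_sq_convex_le (hφ0 p) (hφ1 p) _ _).trans ?_
    have := L.G_le (Q • p)
    have := R.G_le (Q • p)
    nlinarith [hφ0 p, hφ1 p]
  · intro p
    have e : A' p = Complex.I * β / 2 * ((φ p : ℂ) * expoC m p) +
        V p * ((1 - (φ p : ℂ)) * L.A (Q • p) + φ p * R.A (Q • p)) := by
      simp [hA', hφΦ, dil_apply, hc]
    have h1 := norm_node_le hβ0 hβ1 ((φ p : ℂ) * expoC m p)
    rw [norm_mul (φ p : ℂ), norm_expoC_apply, Complex.norm_real, Real.norm_of_nonneg (hφ0 p)] at h1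
    have h2 := norm_mix_le (hV2 p) (hφ0 p) (hφ1 p) (L.A_le (Q • p)) (R.A_le (Q • p))
    rw [e, pow_succ]
    have h3 : (1 : ℝ) ≤ 3 ^ n := one_le_pow₀ (by norm_num)
    refine (norm_add_le _ _).trans ?_
    linarith [hφ1 p]
  · intro p
    have e : (c • expoC m + V * (1 - Φ) * dil Q L.Gp + V * Φ * dil Q R.Gp) p =
        Complex.I * β / 2 * expoC m p +
        V p * ((1 - (φ p : ℂ)) * L.Gp (Q • p) + φ p * R.Gp (Q • p)) := by
      simp only [ContinuousMap.add_apply, ContinuousMap.mul_apply, ContinuousMap.sub_apply,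
        ContinuousMap.smul_apply, ContinuousMap.one_apply, smul_eq_mul, hφΦ, dil_apply, hc]
      ring
    have h1 := norm_node_le hβ0 hβ1 (expoC m p)
    rw [norm_expoC_apply] at h1
    have h2 := norm_mix_le (hV2 p) (hφ0 p) (hφ1 p) (L.Gp_le (Q • p)) (R.Gp_le (Q • p))
    rw [e, pow_succ]
    have h3 : (1 : ℝ) ≤ 3 ^ n := one_le_pow₀ (by norm_num)
    refine (norm_add_le _ _).trans ?_
    linarith
  · rw [hA'mean, hμ, hc]; push_cast; ring
  · have e : A' - algebraMap ℂ _ (mean A') = U + V * ((1 - Φ) * dil Q a + Φ * dil Q b) := by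
      rw [hA'mean, hA'U]; abel
    rw [e]
    refine qvar.trans ?_
    have hB0 : 0 ≤ B := le_trans (by positivity) hB
    have h1 : (1 : ℝ) ≤ (1 + β ^ 2) ^ (n + 1) := one_le_pow₀ (by nlinarith [sq_nonneg β])
    have h2 : B * 1 ≤ B * (1 + β ^ 2) ^ (n + 1) := mul_le_mul_of_nonneg_left h1 hB0
    push_cast
    rw [pow_succ (1 + β ^ 2)] at h2 ⊢
    linarith
  · set bL : Set Torus2 := {p | ∀ τ ∈ L.T, 8 ^ n * ε < ‖L.I τ p - L.A p‖} with hbL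
    set bR : Set Torus2 := {p | ∀ τ ∈ R.T, 8 ^ n * ε < ‖R.I τ p - R.A p‖} with hbR
    set b0 : Set (AddCircle (2 * Real.pi)) :=
      {x | ε < P.eval (circleCos x) ∧ P.eval (circleCos x) < 1 - ε} with hb0
    have hms : ∀ D : ConeData β ε B (stepCoeff P) n s r,
        MeasurableSet {p | ∀ τ ∈ D.T, 8 ^ n * ε < ‖D.I τ p - D.A p‖} := fun D => by
      have : {p | ∀ τ ∈ D.T, 8 ^ n * ε < ‖D.I τ p - D.A p‖} =
          ⋂ τ ∈ D.T, {p | 8 ^ n * ε < ‖D.I τ p - D.A p‖} := by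
        ext p; simp
      rw [this]
      exact D.T.measurableSet_biInter fun τ _ => (isOpen_lt continuous_const
        ((D.I τ).continuous.sub D.A.continuous).norm).measurableSet
    have hmR : MeasurableSet bR := hms R
    have hmL : MeasurableSet bL := by
      have : bL = ⋂ τ ∈ L.T, {p | 8 ^ n * ε < ‖L.I τ p - L.A p‖} := by
        ext p; simp [hbL]
      rw [this]
      exact L.T.measurableSet_biInter fun τ _ => (isOpen_lt continuous_const
        ((L.I τ).continuous.sub L.A.continuous).norm).measurableSet
    have hm0' : MeasurableSet b0 := by
      have hcP : Continuous fun x => P.eval (circleCos x) := P.continuous.comp continuous_circleCos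
      exact ((isOpen_lt continuous_const hcP).inter (isOpen_lt hcP continuous_const)).measurableSet
    have hsub : {p | ∀ τ ∈ L.T ∪ R.T, 8 ^ (n + 1) * ε < ‖I' τ p - A' p‖} ⊆
        freqHom m ⁻¹' b0 ∪ ((fun p => Q • p) ⁻¹' bL ∪ (fun p => Q • p) ⁻¹' bR) := by
      intro p hp
      by_contra hcon
      simp only [Set.mem_union, Set.mem_preimage, not_or] at hcon
      obtain ⟨h1, h2, h3⟩ := hcon
      have h1' : ¬ (ε < φ p ∧ φ p < 1 - ε) := h1
      simp only [hbL, hbR, Set.mem_ofPred_eq, not_forall, not_lt] at h2 h3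
      have eA : A' p = Complex.I * β / 2 * ((φ p : ℂ) * expoC m p) +
          V p * ((1 - (φ p : ℂ)) * L.A (Q • p) + φ p * R.A (Q • p)) := by
        simp [hA', hφΦ, dil_apply, hc]
      rcases le_or_gt (φ p) ε with hlt | hlt
      · obtain ⟨τ, hτ, hle⟩ := h2
        have h4 := hp τ (Finset.mem_union_left _ hτ)
        have eI : I' τ p = V p * (1 - (φ p : ℂ)) * L.I τ (Q • p) := by
          rw [hI'L τ hτ]; simp [hφΦ, dil_apply]
        rw [eI, eA] at h4
        have h5 := norm_drop_right_le hβ0 hβ1 (hV2 p) (hφ0 p) (hφ1 p) hlt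
          (norm_expoC_apply m p).le hle (R.A_le (Q • p))
        have h6 := branch_error_le ε hε n
        have h7 : 0 ≤ ε * 3 ^ n := by positivity
        linarith
      · obtain ⟨τ, hτ, hle⟩ := h3
        have h4 := hp τ (Finset.mem_union_right _ hτ)
        have eI : I' τ p = Complex.I * β / 2 * expoC m p + V p * (1 - (φ p : ℂ)) * L.Gp (Q • p) +
            V p * φ p * R.I τ (Q • p) := by
          rw [hI'R τ hτ]; simp [hφΦ, dil_apply, hc]
        rw [eI, eA] at h4
        have hge : 1 - ε ≤ φ p := not_lt.1 fun h => h1' ⟨hlt, h⟩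
        have h5 := norm_drop_left_le hβ0 hβ1 (hV2 p) (hφ0 p) (hφ1 p) hge
          (norm_expoC_apply m p).le hle (L.A_le (Q • p)) (L.Gp_le (Q • p))
        have h6 := branch_error_le ε hε n
        linarith
    refine (measure_mono hsub).trans ((measure_union_le _ _).trans
      ((add_le_add le_rfl (measure_union_le _ _)).trans ?_))
    have hQ := measurePreserving_nsmul_torus (Q := Q) (by omega)
    rw [(measurePreserving_freqHom hm.ne').measure_preimage hm0'.nullMeasurableSet,
      hQ.measure_preimage hmL.nullMeasurableSet, hQ.measure_preimage hmR.nullMeasurableSet]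
    refine (add_le_add hP.meas (add_le_add L.bad R.bad)).trans ?_
    have h2n : (0 : ℝ) ≤ 2 ^ n - 1 := sub_nonneg.2 (one_le_pow₀ (by norm_num))
    have h2n' : 0 ≤ (2 ^ n - 1) * ε := mul_nonneg h2n hε
    rw [← ENNReal.ofReal_add h2n' h2n', ← ENNReal.ofReal_add hε (by linarith)]
    refine ENNReal.ofReal_le_ofReal ?_
    rw [pow_succ]
    linarith

theorem ConeData.nonempty {β ε B : ℝ} {P : Polynomial ℝ} (hβ0 : 0 ≤ β) (hβ1 : β ≤ 1)
    (hε : 0 ≤ ε) (hP : IsStep P ε) (n : ℕ) (hB : β ^ 2 * (1 + n * β) ^ 2 ≤ B) {s t : ℝ}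
    (hst : s < t) : Nonempty (ConeData β ε B (stepCoeff P) n s t) := by
  induction n generalizing s t with
  | zero => exact ⟨ConeData.zero hε hst⟩
  | succ n ih =>
    have hB' : β ^ 2 * (1 + n * β) ^ 2 ≤ B := by
      refine le_trans ?_ hB
      push_cast
      gcongr
      linarith
    exact ConeData.nonempty_succ hβ0 hβ1 hε hP hB' (fun s t h => ih hB' h) hst

theorem doubleFourierCoeff_eq_mean (f : C(Torus2, ℂ)) (k : ℤ × ℤ) :
    doubleFourierCoeff f k.1 k.2 = mean (f * expoC (-k)) := by
  have h : (∫ p : Torus2, f p * expo (-k.1) (-k.2) p) =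
      ((4 * Real.pi ^ 2 : ℝ) : ℂ) * mean (f * expoC (-k)) := by
    rw [volume_torus_eq, integral_smul_measure, ENNReal.toReal_ofReal (by positivity),
      Complex.real_smul, mean_def]
    rfl
  have hpi : (Real.pi : ℂ) ≠ 0 := by exact_mod_cast Real.pi_ne_zero
  rw [doubleFourierCoeff, h]
  push_cast
  field_simp

/-- The partial sum of the Fourier series over a finite set of frequencies, as a linear map. -/
noncomputable def finsetSum (F : Finset (ℤ × ℤ)) : C(Torus2, ℂ) →ₗ[ℂ] C(Torus2, ℂ) :=
  ∑ k ∈ F, (mean.comp (LinearMap.mulRight ℂ (expoC (-k)))).smulRight (expoC k)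

theorem finsetSum_apply (F : Finset (ℤ × ℤ)) (f : C(Torus2, ℂ)) :
    finsetSum F f = ∑ k ∈ F, mean (f * expoC (-k)) • expoC k := by
  simp [finsetSum]

theorem finsetSum_expoC (F : Finset (ℤ × ℤ)) (l : ℤ × ℤ) :
    finsetSum F (expoC l) = if l ∈ F then expoC l else 0 := by
  rw [finsetSum_apply, ← Finset.sum_ite_eq F l fun _ => expoC l]
  refine Finset.sum_congr rfl fun k _ => ?_
  rw [← expoC_add, mean_expoC, ← sub_eq_add_neg]
  by_cases h : l = k
  · subst h; simp
  · rw [if_neg (sub_ne_zero.2 h), if_neg h, zero_smul]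

theorem finsetSum_eq_self {F : Finset (ℤ × ℤ)} {S : Set (ℤ × ℤ)} (hS : ∀ k ∈ S, k ∈ F)
    {f : C(Torus2, ℂ)} (hf : f ∈ trigPoly S) : finsetSum F f = f := by
  refine trigPoly_induction (P := fun f => finsetSum F f = f) hf (fun k hk => ?_) (map_zero _)
    (fun u v hu hv => ?_) (fun c u hu => ?_)
  · rw [finsetSum_expoC, if_pos (hS k hk)]
  · rw [map_add, hu, hv]
  · rw [map_smul, hu]

theorem finsetSum_eq_zero {F : Finset (ℤ × ℤ)} {S : Set (ℤ × ℤ)} (hS : ∀ k ∈ S, k ∉ F)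
    {f : C(Torus2, ℂ)} (hf : f ∈ trigPoly S) : finsetSum F f = 0 := by
  refine trigPoly_induction (P := fun f => finsetSum F f = 0) hf (fun k hk => ?_) (map_zero _)
    (fun u v hu hv => ?_) (fun c u hu => ?_)
  · rw [finsetSum_expoC, if_neg (hS k hk)]
  · rw [map_add, hu, hv, add_zero]
  · rw [map_smul, hu, smul_zero]

theorem norm_mean_le (f : C(Torus2, ℂ)) : ‖mean f‖ ≤ ‖f‖ := by
  have h := norm_integral_le_of_norm_le_const (μ := torusHaar) (C := ‖f‖) (f := f)
    (ae_of_all _ f.norm_coe_le_norm)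
  simpa [mean_def] using h

theorem norm_expoC_le (k : ℤ × ℤ) : ‖expoC k‖ ≤ 1 :=
  (ContinuousMap.norm_le _ zero_le_one).2 fun p => (norm_expoC_apply k p).le

theorem norm_finsetSum_le (F : Finset (ℤ × ℤ)) (f : C(Torus2, ℂ)) :
    ‖finsetSum F f‖ ≤ F.card * ‖f‖ := by
  rw [finsetSum_apply, ← nsmul_eq_mul]
  refine norm_sum_le_of_le _ (fun k _ => ?_) |>.trans_eq (Finset.sum_const _)
  rw [norm_smul]
  calc ‖mean (f * expoC (-k))‖ * ‖expoC k‖ ≤ (‖f‖ * 1) * 1 := by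
        refine mul_le_mul ((norm_mean_le _).trans ((norm_mul_le _ _).trans ?_)) (norm_expoC_le k)
          (norm_nonneg _) (by positivity)
        exact mul_le_mul_of_nonneg_left (norm_expoC_le _) (norm_nonneg _)
    _ = ‖f‖ := by ring

open Classical in
/-- The integer points of a plane region, as a finite set if there are finitely many. -/
noncomputable def latticePoints (G : Set (ℝ × ℝ)) : Finset (ℤ × ℤ) :=
  if h : {k : ℤ × ℤ | ((k.1 : ℝ), (k.2 : ℝ)) ∈ G}.Finite then h.toFinset else ∅

theorem mem_latticePoints {a b : ℝ} (ha : 0 < a) (hb : 0 < b) (k : ℤ × ℤ) :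
    k ∈ latticePoints (rhombus a b) ↔ a * |(k.1 : ℝ)| + b * |(k.2 : ℝ)| ≤ 1 := by
  rw [latticePoints, dif_pos (finite_lattice_points (isBounded_rhombus ha hb))]
  simp [rhombus]

theorem partialSum_rhombus {a b : ℝ} (ha : 0 < a) (hb : 0 < b) (f : C(Torus2, ℂ)) (p : Torus2) :
    partialSum (rhombus a b) f p = finsetSum (latticePoints (rhombus a b)) f p := by
  have hfin := finite_lattice_points (isBounded_rhombus ha hb)
  rw [latticePoints, dif_pos hfin, partialSum, finsetSum_apply, ContinuousMap.sum_apply]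
  refine (finsum_mem_eq_finite_toFinset_sum
    (fun k : ℤ × ℤ => doubleFourierCoeff f k.1 k.2 * expo k.1 k.2 p) hfin).trans ?_
  refine Finset.sum_congr rfl fun k _ => ?_
  rw [doubleFourierCoeff_eq_mean]; rfl

/-- Frequencies with both coordinates at most `R` in absolute value. -/
def freqBox (R : ℕ) : Set (ℤ × ℤ) := {k | |k.1| ≤ R ∧ |k.2| ≤ R}

theorem eventually_mem_trigPoly_inter_freqBox {S : Set (ℤ × ℤ)} {f : C(Torus2, ℂ)}
    (hf : f ∈ trigPoly S) : ∀ᶠ R : ℕ in atTop, f ∈ trigPoly (S ∩ freqBox R) := by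
  refine trigPoly_induction (P := fun f => ∀ᶠ R : ℕ in atTop, f ∈ trigPoly (S ∩ freqBox R)) hf
    (fun k hk => ?_) (Eventually.of_forall fun _ => zero_mem _) (fun u v hu hv => ?_)
    (fun c u hu => ?_)
  · filter_upwards [eventually_ge_atTop (k.1.natAbs + k.2.natAbs)] with R hR
    exact expoC_mem ⟨hk, by rw [Int.abs_eq_natAbs]; omega, by rw [Int.abs_eq_natAbs]; omega⟩
  · filter_upwards [hu, hv] with R h1 h2 using add_mem h1 h2
  · filter_upwards [hu] with R h using Submodule.smul_mem _ _ h

theorem expoC_mul_mem {S S' : Set (ℤ × ℤ)} {l : ℤ × ℤ} (h : ∀ k ∈ S, l + k ∈ S')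
    {f : C(Torus2, ℂ)} (hf : f ∈ trigPoly S) : expoC l * f ∈ trigPoly S' := by
  refine trigPoly_induction (P := fun f => expoC l * f ∈ trigPoly S') hf (fun k hk => ?_)
    (by simp) (fun u v hu hv => ?_) (fun c u hu => ?_)
  · rw [← expoC_add]; exact expoC_mem (h k hk)
  · rw [mul_add]; exact add_mem hu hv
  · rw [mul_smul_comm]; exact Submodule.smul_mem _ _ hu

/-- A bounded trigonometric polynomial with frequencies in a box of size `2 * N`, whose partial sums
over rhombi of size `N` with ratios in `(1, 1 + δ)` are greater than `M` somewhere, at each point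
outside a set of measure `η`. -/
structure BlockData (M η δ : ℝ) (R : ℕ) where
  N : ℕ
  T : Finset ℝ
  f : C(Torus2, ℂ)
  R_le : R ≤ N
  N_pos : 0 < N
  mem_T : ∀ τ ∈ T, 1 < τ ∧ τ < 1 + δ
  norm_f : ‖f‖ ≤ 1
  f_mem : f ∈ trigPoly (freqBox (2 * N))
  small : torusHaar {p | ∀ τ ∈ T,
    ‖finsetSum (latticePoints (rhombus (τ / N) (1 / N))) f p‖ ≤ M} ≤ ENNReal.ofReal η

theorem finsetSum_shift_eq {τ t : ℝ} (hτ : 1 < τ) {N : ℕ} (hN : 0 < N) {G I : C(Torus2, ℂ)}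
    (hI : I ∈ trigPoly (slopeCone τ t ∩ freqBox N))
    (hJ : G - 1 - I ∈ trigPoly (slopeCone 1 τ ∪ negCone 1 t)) :
    finsetSum (latticePoints (rhombus (τ / N) (1 / N))) (expoC (0, (N : ℤ)) * G) =
      expoC (0, (N : ℤ)) * (1 + I) := by
  have hN' : (0 : ℝ) < N := by exact_mod_cast hN
  have hτ0 : 0 < τ := by linarith
  have hmem : ∀ k : ℤ × ℤ, k ∈ latticePoints (rhombus (τ / N) (1 / N)) ↔
      τ * |(k.1 : ℝ)| + |(k.2 : ℝ)| ≤ N := by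
    intro k
    rw [mem_latticePoints (by positivity) (by positivity)]
    have e : τ / N * |(k.1 : ℝ)| + 1 / N * |(k.2 : ℝ)| =
      (τ * |(k.1 : ℝ)| + |(k.2 : ℝ)|) / N := by ring
    rw [e, div_le_one hN']
  have e : expoC (0, (N : ℤ)) * G = expoC (0, (N : ℤ)) + expoC (0, (N : ℤ)) * I +
      expoC (0, (N : ℤ)) * (G - 1 - I) := by ring
  rw [e, map_add, map_add, finsetSum_expoC, if_pos]
  · rw [finsetSum_eq_self (S := ↑(latticePoints (rhombus (τ / N) (1 / N)))) (fun k hk => hk)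
      (expoC_mul_mem (S := slopeCone τ t ∩ freqBox N) ?_ hI),
      finsetSum_eq_zero (S := {k | k ∉ latticePoints (rhombus (τ / N) (1 / N))}) (fun k hk => hk)
      (expoC_mul_mem (S := slopeCone 1 τ ∪ negCone 1 t) ?_ hJ)]
    · ring
    · rintro k ((⟨h1, h2, h3⟩ | ⟨h1, h2, h3⟩))
      · simp only [Set.mem_ofPred_eq, hmem, Prod.fst_add, Prod.snd_add, zero_add, not_le]
        have h1' : (0 : ℝ) < k.1 := by exact_mod_cast h1
        rw [abs_of_pos h1']
        push_cast
        have := le_abs_self ((N : ℝ) + k.2)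
        linarith
      · simp only [Set.mem_ofPred_eq, hmem, Prod.fst_add, Prod.snd_add, zero_add, not_le]
        simp only [Prod.fst_neg, Prod.snd_neg] at h1 h2 h3
        have h1' : (0 : ℝ) < -k.1 := by exact_mod_cast h1
        push_cast at h2 h3 ⊢
        have := le_abs_self ((N : ℝ) + k.2)
        have : 0 ≤ τ * |(k.1 : ℝ)| := by positivity
        linarith
    · rintro k ⟨⟨h1, h2, h3⟩, h4, h5⟩
      simp only [Finset.mem_coe, hmem, Prod.fst_add, Prod.snd_add, zero_add]
      have h1' : (0 : ℝ) < k.1 := by exact_mod_cast h1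
      have h6 : -(N : ℤ) ≤ k.2 := (abs_le.1 h5).1
      have h6' : -(N : ℝ) ≤ k.2 := by exact_mod_cast h6
      push_cast
      rw [abs_of_pos h1', abs_of_nonneg (by linarith)]
      linarith
  · rw [hmem]; simp

theorem measure_norm_sub_ge_le (A : C(Torus2, ℂ)) (μ : ℂ) {c v : ℝ} (hc : 0 < c)
    (hv : ∫ p, ‖(A - algebraMap ℂ _ μ) p‖ ^ 2 ∂torusHaar ≤ v) :
    torusHaar {p | c ≤ ‖A p - μ‖} ≤ ENNReal.ofReal (v / c ^ 2) := by
  have hcont : Continuous fun p => ‖(A - algebraMap ℂ _ μ) p‖ ^ 2 :=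
    (ContinuousMap.continuous _).norm.pow 2
  have h := mul_meas_ge_le_integral_of_nonneg (μ := torusHaar) (ae_of_all _ fun p => sq_nonneg _)
    (integrable_torusHaar hcont) (c ^ 2)
  have hset : {p | c ≤ ‖A p - μ‖} ⊆ {p | c ^ 2 ≤ ‖(A - algebraMap ℂ _ μ) p‖ ^ 2} :=
    fun p hp => pow_le_pow_left₀ hc.le hp 2
  refine (measure_mono hset).trans ?_
  rw [← ofReal_measureReal]
  refine ENNReal.ofReal_le_ofReal ?_
  rw [le_div_iff₀ (by positivity), mul_comm]
  exact h.trans hv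

theorem BlockData.nonempty (M : ℝ) {η δ : ℝ} (hM : 0 ≤ M) (hη : 0 < η) (hη1 : η ≤ 1) (hδ : 0 < δ)
    (R : ℕ) : Nonempty (BlockData M η δ R) := by
  set θ : ℝ := η / 200 with hθ
  have hθ0 : 0 < θ := by positivity
  have hθ1 : θ ≤ 1 := by rw [hθ]; linarith
  obtain ⟨q, hq⟩ := exists_nat_ge ((64 * M + 65) / θ)
  rw [div_le_iff₀ hθ0] at hq
  have hq0 : (0 : ℝ) < q := by
    by_contra h
    nlinarith
  have hq1 : (1 : ℝ) ≤ q := by exact_mod_cast Nat.one_le_iff_ne_zero.2 (by rintro rfl; simp at hq0)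
  set K := q ^ 2 with hK
  set β : ℝ := θ / q with hβ
  have hβ0 : 0 < β := by positivity
  have hβ1 : β ≤ 1 := by rw [hβ, div_le_one hq0]; linarith
  have hKβ : (K : ℝ) * β = θ * q := by rw [hK, hβ]; push_cast; field_simp
  have hKβ2 : (K : ℝ) * β ^ 2 = θ ^ 2 := by rw [hK, hβ]; push_cast; field_simp
  set ε : ℝ := η / 2 / 8 ^ K with hε
  have hε0 : 0 < ε := by positivity
  have h8 : 8 ^ K * ε = η / 2 := by rw [hε]; field_simp
  obtain ⟨P, hP, hPm, hPκ⟩ := exists_step_polynomial hε0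
  rw [← stepCoeff_re] at hPκ
  obtain ⟨D⟩ := ConeData.nonempty hβ0.le hβ1 hε0.le ⟨hP, hPm⟩ K le_rfl
    (show (1 : ℝ) < 1 + δ by linarith)
  set m := θ * q / 16 with hm
  have hm0 : 0 < m := by positivity
  have hmean : m ≤ ‖mean D.A‖ := by
    have h1 : (1 / 8 : ℝ) ≤ ‖stepCoeff P‖ := hPκ.trans (Complex.re_le_norm _)
    rw [D.A_mean, norm_mul, norm_div, norm_mul, norm_mul, Complex.norm_I, Complex.norm_real,
      Real.norm_of_nonneg hβ0.le, one_mul, Complex.norm_ofNat, Complex.norm_natCast]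
    have e : β * ‖stepCoeff P‖ / 2 * K = (K * β) * ‖stepCoeff P‖ / 2 := by ring
    rw [e, hKβ, hm]
    nlinarith [mul_pos hθ0 hq0]
  have hpow : (1 + β ^ 2) ^ K ≤ 3 := by
    have h1 : 1 + β ^ 2 ≤ Real.exp (β ^ 2) := by linarith [Real.add_one_le_exp (β ^ 2)]
    calc (1 + β ^ 2) ^ K ≤ Real.exp (β ^ 2) ^ K := pow_le_pow_left₀ (by positivity) h1 K
      _ = Real.exp (θ ^ 2) := by rw [← Real.exp_nat_mul, hKβ2]
      _ ≤ Real.exp 1 := Real.exp_le_exp.2 (by nlinarith)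
      _ ≤ 3 := (Real.exp_one_lt_d9.trans (by norm_num)).le
  have hvar : ∫ p, ‖(D.A - algebraMap ℂ _ (mean D.A)) p‖ ^ 2 ∂torusHaar ≤
      12 * θ ^ 2 * (θ * q) ^ 2 := by
    refine D.A_var.trans ?_
    have h1 : (K : ℝ) * (β ^ 2 * (1 + K * β) ^ 2) = θ ^ 2 * (1 + θ * q) ^ 2 := by
      rw [← mul_assoc, hKβ2, hKβ]
    rw [h1]
    have h2 : (1 + θ * q) ^ 2 ≤ 4 * (θ * q) ^ 2 := by nlinarith
    calc θ ^ 2 * (1 + θ * q) ^ 2 * (1 + β ^ 2) ^ K ≤ θ ^ 2 * (4 * (θ * q) ^ 2) * 3 := by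
          gcongr
      _ = _ := by ring
  have hcheb := measure_norm_sub_ge_le D.A (mean D.A) (half_pos hm0) hvar
  obtain ⟨N, hN1, hN2, hNI, hNG⟩ := ((eventually_ge_atTop R).and ((eventually_ge_atTop 1).and (
    ((eventually_all_finset D.T).2 fun τ hτ =>
      eventually_mem_trigPoly_inter_freqBox (D.I_mem τ hτ)).and
    (eventually_mem_trigPoly_inter_freqBox (S := Set.univ) (f := D.G) (by
      have h := add_mem (add_mem (trigPoly_le D.Gn_mem) (trigPoly_le D.Gp_mem)) (one_mem trigAlg)
      have e : D.G - 1 - D.Gp + D.Gp + 1 = D.G := by ring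
      rw [e] at h; exact h))))).exists
  have hsum : ∀ τ ∈ D.T, ∀ p, ‖finsetSum (latticePoints (rhombus (τ / N) (1 / N)))
      ((1 / 2 : ℂ) • (expoC (0, (N : ℤ)) * D.G)) p‖ = ‖1 + D.I τ p‖ / 2 := by
    intro τ hτ p
    rw [map_smul, finsetSum_shift_eq (D.mem_T τ hτ).1 (by omega) (hNI τ hτ) (D.J_mem τ hτ),
      ContinuousMap.smul_apply, norm_smul, ContinuousMap.mul_apply, norm_mul, norm_expoC_apply]
    rw [ContinuousMap.add_apply, ContinuousMap.one_apply]
    norm_num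
    ring
  refine ⟨⟨N, D.T, (1 / 2 : ℂ) • (expoC (0, (N : ℤ)) * D.G), hN1, by omega, D.mem_T, ?_, ?_, ?_⟩⟩
  · refine (ContinuousMap.norm_le _ zero_le_one).2 fun p => ?_
    rw [ContinuousMap.smul_apply, norm_smul, ContinuousMap.mul_apply, norm_mul, norm_expoC_apply]
    have h1 := (D.G_le p).trans hpow
    have h2 : ‖D.G p‖ ≤ 2 := by nlinarith [norm_nonneg (D.G p)]
    norm_num
    linarith
  · refine Submodule.smul_mem _ _ (expoC_mul_mem ?_ hNG)
    rintro k ⟨-, h1, h2⟩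
    rw [abs_le] at h1 h2
    refine ⟨?_, ?_⟩ <;> rw [abs_le] <;> simp <;> omega
  · have hsub : {p | ∀ τ ∈ D.T, ‖finsetSum (latticePoints (rhombus (τ / N) (1 / N)))
        ((1 / 2 : ℂ) • (expoC (0, (N : ℤ)) * D.G)) p‖ ≤ M} ⊆
        {p | m / 2 ≤ ‖D.A p - mean D.A‖} ∪ {p | ∀ τ ∈ D.T, 8 ^ K * ε < ‖D.I τ p - D.A p‖} := by
      intro p hp
      by_contra hcon
      simp only [Set.mem_union, Set.mem_ofPred_eq, not_or, not_le, not_forall, not_lt] at hcon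
      obtain ⟨h1, τ, hτ, h2⟩ := hcon
      have h3 := hp τ hτ
      rw [hsum τ hτ p] at h3
      rw [h8] at h2
      have t1 : ‖mean D.A‖ ≤ ‖D.A p - mean D.A‖ + ‖D.I τ p - D.A p‖ + ‖1 + D.I τ p‖ + 1 := by
        have e : mean D.A = -(D.A p - mean D.A) - (D.I τ p - D.A p) + (1 + D.I τ p) - 1 := by ring
        calc ‖mean D.A‖ = ‖-(D.A p - mean D.A) - (D.I τ p - D.A p) + (1 + D.I τ p) - 1‖ := by
              rw [← e]
          _ ≤ ‖-(D.A p - mean D.A) - (D.I τ p - D.A p) + (1 + D.I τ p)‖ + ‖(1 : ℂ)‖ :=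
              norm_sub_le _ _
          _ ≤ ‖-(D.A p - mean D.A) - (D.I τ p - D.A p)‖ + ‖1 + D.I τ p‖ + 1 := by
              rw [norm_one]; gcongr; exact norm_add_le _ _
          _ ≤ _ := by
              gcongr
              exact (norm_sub_le _ _).trans_eq (by rw [norm_neg])
      linarith
    refine (measure_mono hsub).trans ((measure_union_le _ _).trans
      ((add_le_add hcheb D.bad).trans ?_))
    have h2K : (0 : ℝ) ≤ 2 ^ K - 1 := sub_nonneg.2 (one_le_pow₀ (by norm_num))
    rw [← ENNReal.ofReal_add (by positivity) (mul_nonneg h2K hε0.le)]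
    refine ENNReal.ofReal_le_ofReal ?_
    have e1 : 12 * θ ^ 2 * (θ * q) ^ 2 / (m / 2) ^ 2 = 12288 * θ ^ 2 := by
      rw [hm]; field_simp; norm_num
    have e2 : (2 ^ K - 1) * ε ≤ η / 2 := by
      rw [← h8]
      have : (2 : ℝ) ^ K ≤ 8 ^ K := pow_le_pow_left₀ (by norm_num) (by norm_num) K
      nlinarith
    have e3 : 12288 * θ ^ 2 ≤ η / 2 := by rw [hθ]; nlinarith
    rw [e1]; linarith

theorem exists_antitone_enumeration (T : Finset ℝ) :
    ∃ (K : ℕ) (t : ℕ → ℝ), (∀ i < K, t i ∈ T) ∧ (∀ τ ∈ T, ∃ i < K, t i = τ) ∧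
      ∀ i, i + 1 < K → t (i + 1) ≤ t i := by
  refine Finset.induction_on_max T ⟨0, fun _ => 0, by simp, by simp, by simp⟩ ?_
  · intro a s ha ih
    obtain ⟨K, t, h1, h2, h3⟩ := ih
    refine ⟨K + 1, fun i => Nat.casesOn i a t, ?_, ?_, ?_⟩
    · rintro (_ | i) hi
      · exact Finset.mem_insert_self _ _
      · exact Finset.mem_insert_of_mem (h1 i (by omega))
    · intro τ hτ
      rcases Finset.mem_insert.1 hτ with rfl | h
      · exact ⟨0, by omega, rfl⟩
      · obtain ⟨i, hi, rfl⟩ := h2 τ h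
        exact ⟨i + 1, by omega, rfl⟩
    · rintro (_ | i) hi
      · exact (ha _ (h1 0 (by omega))).le
      · exact h3 i (by omega)

/-- The successor of a position in a concatenation of blocks of lengths `K j`. -/
def blockSucc (K : ℕ → ℕ) (x : ℕ × ℕ) : ℕ × ℕ :=
  if x.2 + 1 < K x.1 then (x.1, x.2 + 1) else (x.1 + 1, 0)

/-- The enumeration of a concatenation of blocks of lengths `K j`. -/
def blockEnum (K : ℕ → ℕ) : ℕ → ℕ × ℕ
  | 0 => (0, 0)
  | k + 1 => blockSucc K (blockEnum K k)

theorem blockEnum_snd_lt {K : ℕ → ℕ} (hK : ∀ j, 0 < K j) (k : ℕ) :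
    (blockEnum K k).2 < K (blockEnum K k).1 := by
  induction k with
  | zero => exact hK 0
  | succ k ih =>
    rw [blockEnum, blockSucc]
    split_ifs with h
    · exact h
    · exact hK _

theorem blockEnum_fst_le (K : ℕ → ℕ) (k : ℕ) : (blockEnum K k).1 ≤ k := by
  induction k with
  | zero => exact le_rfl
  | succ k ih =>
    rw [blockEnum, blockSucc]
    split_ifs
    · exact ih.trans (Nat.le_succ k)
    · exact Nat.succ_le_succ ih

theorem monotone_blockEnum_fst (K : ℕ → ℕ) : Monotone fun k => (blockEnum K k).1 := by
  refine monotone_nat_of_le_succ fun k => ?_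
  change _ ≤ (blockSucc K (blockEnum K k)).1
  rw [blockSucc]
  split_ifs
  · exact le_rfl
  · exact Nat.le_succ _

theorem exists_blockEnum_eq {K : ℕ → ℕ} (hK : ∀ j, 0 < K j) (j i : ℕ) (hi : i < K j) :
    ∃ k, blockEnum K k = (j, i) := by
  have hrow : ∀ j, (∃ k, blockEnum K k = (j, 0)) → ∀ i < K j, ∃ k, blockEnum K k = (j, i) := by
    intro j h0 i
    induction i with
    | zero => exact fun _ => h0
    | succ i ih =>
      intro hi
      obtain ⟨k, hk⟩ := ih (by omega)
      exact ⟨k + 1, by rw [blockEnum, hk, blockSucc, if_pos hi]⟩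
  have hcol : ∀ j, ∃ k, blockEnum K k = (j, 0) := by
    intro j
    induction j with
    | zero => exact ⟨0, rfl⟩
    | succ j ih =>
      obtain ⟨k, hk⟩ := hrow j ih (K j - 1) (Nat.sub_lt (hK j) one_pos)
      refine ⟨k + 1, ?_⟩
      have := hK j
      rw [blockEnum, hk, blockSucc, if_neg (by dsimp only; omega)]
  exact hrow j (hcol j) i hi

theorem tendsto_blockEnum_fst {K : ℕ → ℕ} (hK : ∀ j, 0 < K j) :
    Tendsto (fun k => (blockEnum K k).1) atTop atTop := by
  refine tendsto_atTop_atTop_of_monotone (monotone_blockEnum_fst K) fun j => ?_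
  obtain ⟨k, hk⟩ := exists_blockEnum_eq hK j 0 (hK j)
  exact ⟨k, by rw [hk]⟩

theorem rhombus_subset {a b a' b' : ℝ} (ha : a' ≤ a) (hb : b' ≤ b) :
    rhombus a b ⊆ rhombus a' b' := by
  intro z hz
  have hz' : a * |z.1| + b * |z.2| ≤ 1 := hz
  change a' * |z.1| + b' * |z.2| ≤ 1
  nlinarith [abs_nonneg z.1, abs_nonneg z.2]

theorem card_latticePoints_le {τ : ℝ} (hτ : 1 < τ) {N : ℕ} (hN : 0 < N) :
    ((latticePoints (rhombus (τ / N) (1 / N))).card : ℝ) ≤ (2 * N + 1) ^ 2 := by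
  have hN' : (0 : ℝ) < N := by exact_mod_cast hN
  have hsub : latticePoints (rhombus (τ / N) (1 / N)) ⊆
      Finset.Icc (-(N : ℤ)) N ×ˢ Finset.Icc (-(N : ℤ)) N := by
    intro k hk
    rw [mem_latticePoints (by positivity) (by positivity)] at hk
    have e : τ / N * |(k.1 : ℝ)| + 1 / N * |(k.2 : ℝ)| =
      (τ * |(k.1 : ℝ)| + |(k.2 : ℝ)|) / N := by ring
    rw [e, div_le_one hN'] at hk
    have h1 : |(k.1 : ℝ)| ≤ N := by nlinarith [abs_nonneg (k.1 : ℝ), abs_nonneg (k.2 : ℝ)]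
    have h2 : |(k.2 : ℝ)| ≤ N := by nlinarith [abs_nonneg (k.1 : ℝ), abs_nonneg (k.2 : ℝ)]
    rw [Finset.mem_product, Finset.mem_Icc, Finset.mem_Icc, ← abs_le, ← abs_le]
    exact ⟨by exact_mod_cast h1, by exact_mod_cast h2⟩
  have h := Finset.card_le_card hsub
  rw [Finset.card_product, Int.card_Icc] at h
  have e : ((N : ℤ) + 1 - -(N : ℤ)).toNat = 2 * N + 1 := by omega
  rw [e] at h
  calc ((latticePoints (rhombus (τ / N) (1 / N))).card : ℝ) ≤
      (((2 * N + 1) * (2 * N + 1) : ℕ) : ℝ) := by exact_mod_cast h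
    _ = _ := by push_cast; ring

theorem finsetSum_of_freqBox {τ : ℝ} (hτ : 1 < τ) (hτ2 : τ < 2) {N R : ℕ} (hN : 0 < N)
    (hR : 3 * R ≤ N) {f : C(Torus2, ℂ)} (hf : f ∈ trigPoly (freqBox R)) :
    finsetSum (latticePoints (rhombus (τ / N) (1 / N))) f = f := by
  have hN' : (0 : ℝ) < N := by exact_mod_cast hN
  have hR' : (3 : ℝ) * R ≤ N := by exact_mod_cast hR
  refine finsetSum_eq_self (fun k hk => ?_) hf
  rw [mem_latticePoints (by positivity) (by positivity)]
  have e : τ / N * |(k.1 : ℝ)| + 1 / N * |(k.2 : ℝ)| =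
    (τ * |(k.1 : ℝ)| + |(k.2 : ℝ)|) / N := by ring
  rw [e, div_le_one hN']
  have h1 : |(k.1 : ℝ)| ≤ R := by exact_mod_cast hk.1
  have h2 : |(k.2 : ℝ)| ≤ R := by exact_mod_cast hk.2
  nlinarith [abs_nonneg (k.1 : ℝ)]

/-- The size of the frequencies used before stage `j`, for a choice of blocks. -/
noncomputable def stageRadius (N : ℕ → ℕ → ℕ) : ℕ → ℕ
  | 0 => 1
  | j + 1 => 6 * N j (stageRadius N j)

/-- Blocks of rapidly growing frequencies and rapidly decreasing weights. -/
structure BlockSeq where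
  N : ℕ → ℕ
  T : ℕ → Finset ℝ
  f : ℕ → C(Torus2, ℂ)
  w : ℕ → ℝ
  N_pos : ∀ j, 0 < N j
  N_growth : ∀ j, 6 * N j ≤ N (j + 1)
  mem_T : ∀ j, ∀ τ ∈ T j, 1 < τ ∧ τ < 1 + 1 / ((j : ℝ) + 1)
  T_nonempty : ∀ j, (T j).Nonempty
  norm_f : ∀ j, ‖f j‖ ≤ 1
  f_mem : ∀ j, f j ∈ trigPoly (freqBox (2 * N j))
  w_pos : ∀ j, 0 < w j
  w_le : ∀ j, w j ≤ (1 / 2) ^ (j + 1)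
  w_mul_le : ∀ i j, i < j → w j * (2 * N i + 1) ^ 2 ≤ (1 / 2) ^ (j + 1)
  small : ∀ j, torusHaar {p | ∀ τ ∈ T j,
    ‖finsetSum (latticePoints (rhombus (τ / N j) (1 / N j))) (f j) p‖ ≤ (j + 3) / w j} ≤
      ENNReal.ofReal ((1 / 2) ^ (j + 1))

theorem BlockSeq.nonempty : Nonempty BlockSeq := by
  set w : ℕ → ℕ → ℝ := fun j R => (1 / 2) ^ (j + 1) / (2 * R + 1) ^ 2 with hw
  have hwpos : ∀ j R, 0 < w j R := fun j R => by simp only [hw]; positivity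
  have hblk : ∀ j R : ℕ, Nonempty
      (BlockData ((j + 3) / w j R) ((1 / 2) ^ (j + 1)) (1 / ((j : ℝ) + 1)) R) := fun j R =>
    BlockData.nonempty _ (div_nonneg (by positivity) (hwpos j R).le) (by positivity)
      (pow_le_one₀ (by norm_num) (by norm_num)) (by positivity) R
  obtain ⟨blk⟩ : Nonempty (∀ j R : ℕ,
      BlockData ((j + 3) / w j R) ((1 / 2) ^ (j + 1)) (1 / ((j : ℝ) + 1)) R) :=
    ⟨fun j R => (hblk j R).some⟩
  set ρ := stageRadius fun j R => (blk j R).N with hρ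
  set N : ℕ → ℕ := fun j => (blk j (ρ j)).N with hN
  have hρN : ∀ j, ρ j ≤ N j := fun j => (blk j (ρ j)).R_le
  have hgrow : ∀ j, 6 * N j ≤ N (j + 1) := fun j => hρN (j + 1)
  have hmono : Monotone N := monotone_nat_of_le_succ fun j => by have := hgrow j; omega
  have hNρ : ∀ i j, i < j → N i ≤ ρ j := by
    intro i j hij
    obtain ⟨k, rfl⟩ : ∃ k, j = k + 1 := ⟨j - 1, by omega⟩
    have h1 : N i ≤ N k := hmono (by omega)
    have h2 : ρ (k + 1) = 6 * N k := rfl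
    omega
  refine ⟨{
    N := N
    T := fun j => (blk j (ρ j)).T
    f := fun j => (blk j (ρ j)).f
    w := fun j => w j (ρ j)
    N_pos := fun j => (blk j (ρ j)).N_pos
    N_growth := hgrow
    mem_T := fun j => (blk j (ρ j)).mem_T
    T_nonempty := fun j => ?_
    norm_f := fun j => (blk j (ρ j)).norm_f
    f_mem := fun j => (blk j (ρ j)).f_mem
    w_pos := fun j => hwpos _ _
    w_le := fun j => ?_
    w_mul_le := fun i j hij => ?_
    small := fun j => (blk j (ρ j)).small }⟩
  · by_contra h
    rw [Finset.not_nonempty_iff_eq_empty] at h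
    have hs := (blk j (ρ j)).small
    rw [h] at hs
    simp only [Finset.notMem_empty, false_imp_iff, implies_true, Set.ofPred_true, measure_univ] at hs
    rw [ENNReal.one_le_ofReal] at hs
    exact absurd hs (not_le.2 (pow_lt_one₀ (by norm_num) (by norm_num) (by omega)))
  · refine div_le_self (by positivity) (one_le_pow₀ ?_)
    linarith [Nat.cast_nonneg (α := ℝ) (ρ j)]
  · have h : (N i : ℝ) ≤ ρ j := by exact_mod_cast hNρ i j hij
    rw [hw]
    simp only
    rw [div_mul_eq_mul_div, div_le_iff₀ (by positivity)]
    gcongr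

namespace BlockSeq

variable (S : BlockSeq)

theorem norm_term_le (j : ℕ) : ‖(S.w j : ℂ) • S.f j‖ ≤ S.w j := by
  rw [norm_smul, Complex.norm_real, Real.norm_of_nonneg (S.w_pos j).le]
  exact mul_le_of_le_one_right (S.w_pos j).le (S.norm_f j)

theorem hasSum_half_pow (c : ℝ) : HasSum (fun i : ℕ => c * (1 / 2) ^ (i + 1)) c := by
  have h := hasSum_geometric_two' c
  have e : (fun i : ℕ => c * (1 / 2 : ℝ) ^ (i + 1)) = fun i => c / 2 / 2 ^ i := by
    ext i; rw [one_div, inv_pow, pow_succ]; field_simp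
  rw [e]; exact h

theorem summable_term : Summable fun j => (S.w j : ℂ) • S.f j :=
  Summable.of_norm_bounded (hasSum_half_pow 1).summable fun j => by
    rw [one_mul]; exact (S.norm_term_le j).trans (S.w_le j)

/-- The weighted sum of the blocks. -/
noncomputable def sum : C(Torus2, ℂ) := ∑' j, (S.w j : ℂ) • S.f j

theorem N_mono : Monotone S.N := monotone_nat_of_le_succ fun j => by have := S.N_growth j; omega

theorem lt_N (j : ℕ) : j < S.N j := by
  induction j with
  | zero => exact S.N_pos 0
  | succ j ih => have := S.N_growth j; omega

theorem lt_two {j : ℕ} {τ : ℝ} (hτ : τ ∈ S.T j) : τ < 2 := by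
  have h : 1 / ((j : ℝ) + 1) ≤ 1 := by
    rw [div_le_one (by positivity)]; linarith [Nat.cast_nonneg (α := ℝ) j]
  linarith [(S.mem_T j τ hτ).2]

/-- A large partial sum of one block is a large partial sum of the whole function. -/
theorem lt_norm_finsetSum_sum {j : ℕ} {τ : ℝ} (hτ : τ ∈ S.T j) {p : Torus2}
    (hp : (j + 3) / S.w j <
      ‖finsetSum (latticePoints (rhombus (τ / S.N j) (1 / S.N j))) (S.f j) p‖) :
    j + 1 < ‖finsetSum (latticePoints (rhombus (τ / S.N j) (1 / S.N j))) S.sum p‖ := by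
  set L := finsetSum (latticePoints (rhombus (τ / S.N j) (1 / S.N j))) with hL
  set g : ℕ → C(Torus2, ℂ) := fun i => (S.w i : ℂ) • S.f i with hg
  set head := ∑ i ∈ Finset.range j, g i with hhead
  set tail := ∑' i, g (i + (j + 1)) with htail
  have hsum : S.sum = head + g j + tail := by
    have h := S.summable_term.sum_add_tsum_nat_add (j + 1)
    rw [Finset.sum_range_succ] at h
    exact h.symm
  have hLhead : L head = head := by
    rw [hhead, map_sum]
    refine Finset.sum_congr rfl fun i hi => ?_
    have hij : i < j := Finset.mem_range.1 hi
    have h1 := S.N_growth i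
    have h2 : S.N (i + 1) ≤ S.N j := S.N_mono hij
    simp only [hg, map_smul]
    rw [hL, finsetSum_of_freqBox (S.mem_T j τ hτ).1 (S.lt_two hτ) (S.N_pos j) (by omega) (S.f_mem i)]
  have hhead1 : ‖head‖ ≤ 1 := by
    refine (norm_sum_le _ _).trans ?_
    have h1 : ∑ i ∈ Finset.range j, ‖g i‖ ≤ ∑ i ∈ Finset.range j, 1 * (1 / 2 : ℝ) ^ (i + 1) :=
      Finset.sum_le_sum fun i _ => by rw [one_mul]; exact (S.norm_term_le i).trans (S.w_le i)
    exact h1.trans (sum_le_hasSum _ (fun i _ => by positivity) (hasSum_half_pow 1))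
  have hC : (0 : ℝ) < (2 * S.N j + 1) ^ 2 := by positivity
  have htail1 : ‖tail‖ ≤ 1 / (2 * S.N j + 1) ^ 2 := by
    refine tsum_of_norm_bounded (hasSum_half_pow _) fun i => ?_
    refine (S.norm_term_le _).trans ?_
    have h := S.w_mul_le j (i + (j + 1)) (by omega)
    have h2 : (1 / 2 : ℝ) ^ (i + (j + 1) + 1) ≤ (1 / 2) ^ (i + 1) :=
      pow_le_pow_of_le_one (by norm_num) (by norm_num) (by omega)
    rw [one_div_mul_eq_div, le_div_iff₀ hC]
    exact h.trans h2
  have hLtail : ‖L tail p‖ ≤ 1 := by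
    refine ((L tail).norm_coe_le_norm p).trans ((norm_finsetSum_le _ _).trans ?_)
    calc _ ≤ (2 * (S.N j : ℝ) + 1) ^ 2 * (1 / (2 * S.N j + 1) ^ 2) :=
          mul_le_mul (card_latticePoints_le (S.mem_T j τ hτ).1 (S.N_pos j)) htail1 (norm_nonneg _)
            hC.le
      _ = 1 := mul_one_div_cancel hC.ne'
  have hLg : j + 3 < ‖L (g j) p‖ := by
    simp only [hg, map_smul]
    rw [ContinuousMap.smul_apply, norm_smul, Complex.norm_real,
      Real.norm_of_nonneg (S.w_pos j).le, mul_comm, ← div_lt_iff₀ (S.w_pos j)]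
    exact hp
  have e : L (g j) p = L S.sum p - head p - L tail p := by
    rw [hsum, map_add, map_add, hLhead]
    simp only [ContinuousMap.add_apply]; ring
  have h1 := (norm_sub_le (L S.sum p - head p) (L tail p)).trans
    (add_le_add (norm_sub_le (L S.sum p) (head p)) le_rfl)
  rw [← e] at h1
  have h2 := (head.norm_coe_le_norm p).trans hhead1
  linarith

theorem ae_eventually_exists_lt : ∀ᵐ p ∂torusHaar, ∀ᶠ j in atTop, ∃ τ ∈ S.T j,
    (j : ℝ) + 1 < ‖finsetSum (latticePoints (rhombus (τ / S.N j) (1 / S.N j))) S.sum p‖ := by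
  have h := ae_eventually_notMem (μ := torusHaar) (s := fun j => {p | ∀ τ ∈ S.T j,
    ‖finsetSum (latticePoints (rhombus (τ / S.N j) (1 / S.N j))) (S.f j) p‖ ≤ (j + 3) / S.w j}) (by
      refine ne_top_of_le_ne_top ?_ (ENNReal.tsum_le_tsum S.small)
      rw [← ENNReal.ofReal_tsum_of_nonneg (fun j => by positivity)]
      · exact ENNReal.ofReal_ne_top
      · simpa using (hasSum_half_pow 1).summable)
  filter_upwards [h] with p hp
  filter_upwards [hp] with j hj
  simp only [not_forall, not_le] at hj
  obtain ⟨τ, hτ, h⟩ := hj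
  exact ⟨τ, hτ, S.lt_norm_finsetSum_sum hτ h⟩

end BlockSeq

theorem rho_rhombus {τ N : ℝ} (hτ : 1 < τ) (hN : 0 < N) : rho (τ / N) (1 / N) = τ := by
  have h : 1 / N ≤ τ / N := by gcongr
  rw [rho, max_eq_left h, min_eq_right h]
  field_simp

theorem exists_complex_divergent :
    ∃ (F : C(Torus2, ℂ)) (a b : ℕ → ℝ), (∀ k, 0 < a k ∧ 0 < b k) ∧
      (⋃ k, rhombus (a k) (b k)) = Set.univ ∧
      (∀ k, rhombus (a k) (b k) ⊆ rhombus (a (k + 1)) (b (k + 1))) ∧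
      Tendsto (fun k => rho (a k) (b k)) atTop (𝓝 1) ∧
      ∀ᵐ p : Torus2,
        limsup (fun k => ‖finsetSum (latticePoints (rhombus (a k) (b k))) F p‖ₑ) atTop = ⊤ := by
  obtain ⟨S⟩ := BlockSeq.nonempty
  choose K t ht1 ht2 ht3 using fun j => exists_antitone_enumeration (S.T j)
  have hK : ∀ j, 0 < K j := by
    intro j
    obtain ⟨τ, hτ⟩ := S.T_nonempty j
    obtain ⟨i, hi, -⟩ := ht2 j τ hτ
    omega
  set e := blockEnum K with he
  set N : ℕ → ℝ := fun k => S.N (e k).1 with hN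
  set τ : ℕ → ℝ := fun k => t (e k).1 (e k).2 with hτ
  have hτT : ∀ k, τ k ∈ S.T (e k).1 := fun k => ht1 _ _ (blockEnum_snd_lt hK k)
  have hN0 : ∀ k, 0 < N k := fun k => by simp only [hN]; exact_mod_cast S.N_pos _
  have hτ1 : ∀ k, 1 < τ k := fun k => (S.mem_T _ _ (hτT k)).1
  have hτ2 : ∀ k, τ k < 2 := fun k => S.lt_two (hτT k)
  have hτ0 : ∀ k, 0 < τ k := fun k => zero_lt_one.trans (hτ1 k)
  have hfst := tendsto_blockEnum_fst hK
  refine ⟨S.sum, fun k => τ k / N k, fun k => 1 / N k,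
    fun k => ⟨div_pos (hτ0 k) (hN0 k), one_div_pos.2 (hN0 k)⟩, ?_, ?_, ?_, ?_⟩
  · refine Set.eq_univ_of_forall fun z => Set.mem_iUnion.2 ?_
    obtain ⟨n, hn⟩ := exists_nat_ge (2 * |z.1| + |z.2|)
    obtain ⟨k, hk⟩ := (hfst.eventually_ge_atTop n).exists
    have h1 : (n : ℝ) ≤ N k := by
      have hk' : n ≤ (e k).1 := hk
      have := S.lt_N (e k).1
      simp only [hN]
      exact_mod_cast (show n ≤ S.N (e k).1 by omega)
    refine ⟨k, ?_⟩
    change τ k / N k * |z.1| + 1 / N k * |z.2| ≤ 1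
    have e1 : τ k / N k * |z.1| + 1 / N k * |z.2| = (τ k * |z.1| + |z.2|) / N k := by ring
    rw [e1, div_le_one (hN0 k)]
    nlinarith [abs_nonneg z.1, hτ2 k]
  · intro k
    have hstep : e (k + 1) = blockSucc K (e k) := rfl
    rw [blockSucc] at hstep
    split_ifs at hstep with h
    · have hNe : N (k + 1) = N k := by simp only [hN, hstep]
      have hτe : τ (k + 1) ≤ τ k := by
        simp only [hτ, hstep]; exact ht3 _ _ h
      refine rhombus_subset ?_ ?_
      · change τ (k + 1) / N (k + 1) ≤ τ k / N k
        rw [hNe]; exact div_le_div_of_nonneg_right hτe (hN0 k).le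
      · change 1 / N (k + 1) ≤ 1 / N k
        rw [hNe]
    · have hNe : 6 * N k ≤ N (k + 1) := by
        simp only [hN, hstep]; exact_mod_cast S.N_growth _
      refine rhombus_subset ?_ ?_
      · change τ (k + 1) / N (k + 1) ≤ τ k / N k
        rw [div_le_div_iff₀ (hN0 _) (hN0 _)]
        nlinarith [hτ2 (k + 1), hτ1 k, hN0 k, hN0 (k + 1)]
      · exact one_div_le_one_div_of_le (hN0 k) (by linarith [hN0 k])
  · have h1 : (fun k => rho (τ k / N k) (1 / N k)) = τ := by
      ext k; exact rho_rhombus (hτ1 k) (hN0 k)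
    rw [h1]
    have h2 : Tendsto (fun k => 1 + 1 / (((e k).1 : ℝ) + 1)) atTop (𝓝 1) := by
      have := (tendsto_one_div_add_atTop_nhds_zero_nat (𝕜 := ℝ)).comp hfst
      simpa using this.const_add 1
    exact tendsto_of_tendsto_of_tendsto_of_le_of_le tendsto_const_nhds h2 (fun k => (hτ1 k).le)
      fun k => (S.mem_T _ _ (hτT k)).2.le
  · rw [volume_torus_eq]
    refine Measure.ae_smul_measure ?_ _
    filter_upwards [S.ae_eventually_exists_lt] with p hp
    rw [eq_top_iff]
    refine ENNReal.le_of_forall_nnreal_lt fun r _ => ?_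
    refine le_limsup_of_frequently_le ?_
    rw [frequently_atTop]
    intro k₀
    obtain ⟨j, ⟨σ, hσ, hj⟩, hj1, hj2⟩ := (hp.and ((eventually_ge_atTop k₀).and
      (eventually_ge_atTop ⌈(r : ℝ)⌉₊))).exists
    obtain ⟨i, hi, rfl⟩ := ht2 j σ hσ
    obtain ⟨k, hk⟩ := exists_blockEnum_eq hK j i hi
    have hkj : j ≤ k := by have := blockEnum_fst_le K k; rw [hk] at this; exact this
    refine ⟨k, hj1.trans hkj, ?_⟩
    have hek : e k = (j, i) := hk
    simp only [hN, hτ, hek]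
    rw [← ofReal_norm, ← ENNReal.ofReal_coe_nnreal]
    refine ENNReal.ofReal_le_ofReal ?_
    have : (r : ℝ) ≤ j := (Nat.le_ceil _).trans (by exact_mod_cast hj2)
    linarith

/-- A real continuous function, as a complex one. -/
noncomputable def complexify (u : C(Torus2, ℝ)) : C(Torus2, ℂ) :=
  ⟨fun q => (u q : ℂ), Complex.continuous_ofReal.comp u.continuous⟩

/-- If a complex function has unbounded partial sums almost everywhere, so has some real combination
of its real and imaginary parts. -/
theorem exists_real_divergent (A : ℕ → C(Torus2, ℂ) →ₗ[ℂ] C(Torus2, ℂ)) (F : C(Torus2, ℂ))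
    (hF : ∀ᵐ p : Torus2, limsup (fun k => ‖A k F p‖ₑ) atTop = ⊤) :
    ∃ f : C(Torus2, ℝ), ∀ᵐ p : Torus2, limsup (fun k => ‖A k (complexify f) p‖ₑ) atTop = ⊤ := by
  set u : C(Torus2, ℝ) := ⟨fun p => (F p).re, Complex.continuous_re.comp F.continuous⟩ with hu
  set v : C(Torus2, ℝ) := ⟨fun p => (F p).im, Complex.continuous_im.comp F.continuous⟩ with hv
  set bad : ℝ → Set Torus2 := fun t =>
    {p | limsup (fun k => ‖A k (complexify (u + t • v)) p‖ₑ) atTop ≠ ⊤} with hbad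
  have hmeas : ∀ t, NullMeasurableSet (bad t) := by
    intro t
    have : Measurable fun p => limsup (fun k => ‖A k (complexify (u + t • v)) p‖ₑ) atTop :=
      Measurable.limsup fun k => (A k _).continuous.enorm.measurable
    exact (this (measurableSet_singleton (⊤ : ENNReal)).compl).nullMeasurableSet
  have hdisj : Pairwise (Function.onFun (AEDisjoint volume) bad) := by
    intro s t hst
    refine measure_mono_null ?_ (ae_iff.1 hF)
    rintro p ⟨hs, ht⟩
    have hst' : ((s : ℂ) - t) ≠ 0 := sub_ne_zero.2 (by exact_mod_cast hst)
    set α : ℂ := (Complex.I - t) / (s - t) with hα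
    set β : ℂ := (s - Complex.I) / (s - t) with hβ
    have hFe : F = α • complexify (u + s • v) + β • complexify (u + t • v) := by
      ext q
      have e1 : α + β = 1 := by rw [hα, hβ]; field_simp; ring
      have e2 : α * s + β * t = Complex.I := by rw [hα, hβ]; field_simp; ring
      have e3 : (α • complexify (u + s • v) + β • complexify (u + t • v)) q =
          (α + β) * ((F q).re : ℂ) + (α * s + β * t) * ((F q).im : ℂ) := by
        simp [complexify, hu, hv]; ring
      rw [e3, e1, e2, one_mul, mul_comm Complex.I, Complex.re_add_im]
    have hle : ∀ k, ‖A k F p‖ₑ ≤ ‖α‖ₑ * ‖A k (complexify (u + s • v)) p‖ₑ +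
        ‖β‖ₑ * ‖A k (complexify (u + t • v)) p‖ₑ := by
      intro k
      rw [← enorm_mul, ← enorm_mul]
      refine le_trans (le_of_eq ?_) (enorm_add_le _ _)
      conv_lhs => rw [hFe]
      rw [map_add, map_smul, map_smul]; rfl
    obtain ⟨c, hc, hc'⟩ := exists_between (lt_top_iff_ne_top.2 hs)
    obtain ⟨d, hd, hd'⟩ := exists_between (lt_top_iff_ne_top.2 ht)
    have hlim : limsup (fun k => ‖A k F p‖ₑ) atTop ≤ ‖α‖ₑ * c + ‖β‖ₑ * d := by
      refine limsup_le_of_le (by isBoundedDefault) ?_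
      filter_upwards [eventually_lt_of_limsup_lt hc, eventually_lt_of_limsup_lt hd] with k h1 h2
      exact (hle k).trans (add_le_add (mul_le_mul_right h1.le _) (mul_le_mul_right h2.le _))
    exact ne_top_of_le_ne_top (ENNReal.add_ne_top.2
      ⟨ENNReal.mul_ne_top enorm_ne_top hc'.ne, ENNReal.mul_ne_top enorm_ne_top hd'.ne⟩) hlim
  have hcount := Measure.countable_meas_pos_of_disjoint_iUnion₀ hmeas hdisj
  obtain ⟨t, ht⟩ : ∃ t, t ∉ {t | 0 < volume (bad t)} := by
    by_contra h
    push Not at h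
    exact Set.not_countable_univ (hcount.mono fun t _ => h t)
  refine ⟨u + t • v, ae_iff.2 ?_⟩
  simpa using ht

theorem theorem1 :
    ∃ (f : C(Torus2, ℝ)) (a b : ℕ → ℝ),
      (∀ k, 0 < a k ∧ 0 < b k) ∧
      (⋃ k, rhombus (a k) (b k)) = Set.univ ∧
      (∀ k, rhombus (a k) (b k) ⊆ rhombus (a (k + 1)) (b (k + 1))) ∧
      Tendsto (fun k => rho (a k) (b k)) atTop (𝓝 1) ∧
      ∀ᵐ p : Torus2,
        limsup (fun k => ‖partialSum (rhombus (a k) (b k)) (fun q => (f q : ℂ)) p‖ₑ) atTop = ⊤ := by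
  obtain ⟨F, a, b, h0, h1, h2, h3, hF⟩ := exists_complex_divergent
  obtain ⟨f, hf⟩ := exists_real_divergent (fun k => finsetSum (latticePoints (rhombus (a k) (b k))))
    F hF
  refine ⟨f, a, b, h0, h1, h2, h3, ?_⟩
  filter_upwards [hf] with p hp
  rw [← hp]
  congr 1; ext k
  exact congrArg _ (partialSum_rhombus (h0 k).1 (h0 k).2 (complexify f) p)
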